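/- Let $X$ be an $n$-dimensional normal complex algebraic variety (an integral separated scheme of finite type over $\mathbb{C}$ whose local rings are integrally closed) and let $B$ be a Weil divisor on $X$ such that $(X,B)$ is a cluster type pair. This means that there are a closed subset $Z\subset \mathbb{G}_m^n=\operatorname{Spec}\mathbb{C}[x_1^{\pm 1},\dots,x_n^{\pm 1}]$ of codimension at least two (possibly empty) and an open embedding $j\colon \mathbb{G}_m^n\setminus Z\hookrightarrow X$ over $\mathbb{C}$ such that the volume form $$\Omega_n=\frac{dx_1\wedge\dots\wedge dx_n}{x_1\cdots x_n},$$ regarded via $j$ as a rational $n$-form on $X$, has no zeros along any prime divisor of $X$, and $B$ is the divisor of poles of this form. Let $X^{\rm sm}$ be the smooth locus of $X$, and equip the set of complex points of $X^{\rm sm}\setminus B$ (the complement in $X^{\rm sm}$ of the support of $B$) with the Euclidean topology. Then $X^{\rm sm}\setminus B$ is path-connected, and for every base point its fundamental group $\pi_1(X^{\rm sm}\setminus B)$ is abelian of rank at most $n=\dim X$, that is, it can be generated by at most $n$ elements; in other words, there is a surjective homomorphism $\mathbb{Z}^n\to \pi_1(X^{\rm sm}\setminus B)$. -/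

import Mathlib

open AlgebraicGeometry CategoryTheory

noncomputable section

namespace ClusterType

/-- The base scheme `Spec ℂ`. -/
abbrev SpecC : Scheme.{0} := Spec (.of ℂ)

/-! ### Complex points with the Euclidean topology -/

/-- The set `X(ℂ)` of complex points of a scheme over `ℂ`. -/
def ComplexPoints (X : Scheme.{0}) [X.Over SpecC] : Type :=
  {p : SpecC ⟶ X // p ≫ (X ↘ SpecC) = 𝟙 SpecC}

namespace ComplexPoints

variable {X : Scheme.{0}} [X.Over SpecC]

/-- The underlying (closed) point of `X`. -/
def pt (p : ComplexPoints X) : X := p.1 (IsLocalRing.closedPoint ℂ)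

/-- The value at `p` of a regular function defined on an open `U` through which `p` factors. -/
def eval (p : ComplexPoints X) (U : X.Opens) (h : ⊤ ≤ p.1 ⁻¹ᵁ U) (f : Γ(X, U)) : ℂ :=
  (Scheme.ΓSpecIso (.of ℂ)).hom (p.1.appLE U ⊤ h f)

/-- The Euclidean (analytic) topology on `X(ℂ)`: the coarsest one in which `U(ℂ)` is open
for every Zariski open `U` and every regular function `U(ℂ) → ℂ` is continuous. -/
instance : TopologicalSpace (ComplexPoints X) :=
  TopologicalSpace.generateFrom
    {S | ∃ (U : X.Opens) (f : Γ(X, U)) (W : Set ℂ), IsOpen W ∧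
      S = {p | ∃ h : ⊤ ≤ p.1 ⁻¹ᵁ U, p.eval U h f ∈ W}}

end ComplexPoints

/-! ### The algebraic torus -/

/-- The algebraic torus `𝔾ₘⁿ = Spec ℂ[x₁^±, …, xₙ^±]`. -/
def torus (n : ℕ) : Scheme.{0} := Spec (.of (AddMonoidAlgebra ℂ (Fin n → ℤ)))

instance (n : ℕ) : (torus n).Over SpecC :=
  ⟨Spec.map (CommRingCat.ofHom (algebraMap ℂ (AddMonoidAlgebra ℂ (Fin n → ℤ))))⟩

/-- The coordinate function `xᵢ` on the torus. -/
def torusCoord (n : ℕ) (i : Fin n) : Γ(torus n, ⊤) :=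
  (Scheme.ΓSpecIso (.of (AddMonoidAlgebra ℂ (Fin n → ℤ)))).inv
    (AddMonoidAlgebra.single (Pi.single i 1) 1)

instance (n : ℕ) : IsIntegral (torus n) := by
  unfold torus
  infer_instance

/-- An embedding in codimension one `𝔾ₘⁿ ⇢ X`: an open embedding over `ℂ` of `𝔾ₘⁿ ∖ Z`,
where `Z` is a closed subset all of whose points have codimension at least two. -/
structure CodimOneEmbedding (n : ℕ) (X : Scheme.{0}) [X.Over SpecC] where
  /-- The open subset `𝔾ₘⁿ ∖ Z`. -/
  dom : (torus n).Opens
  two_le_codim : ∀ z : torus n, z ∉ dom → 2 ≤ Order.coheight z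
  /-- The embedding of `𝔾ₘⁿ ∖ Z`. -/
  hom : dom.toScheme ⟶ X
  isOver : hom.IsOver SpecC
  isOpenImmersion : IsOpenImmersion hom

attribute [instance] CodimOneEmbedding.isOver CodimOneEmbedding.isOpenImmersion

/-! ### Rational differential forms -/

section Forms

variable (X : Scheme.{0}) [X.Over SpecC] [IsIntegral X]

/-- The function field of an integral scheme over `ℂ` as a `ℂ`-algebra. -/
instance functionFieldAlgebra : Algebra ℂ X.functionField :=
  ((Scheme.ΓSpecIso (.of ℂ)).inv ≫ (X ↘ SpecC).appTop ≫
    X.presheaf.germ ⊤ (genericPoint X) trivial).hom.toAlgebra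

/-- Rational differential `n`-forms on `X`. -/
abbrev RationalForm (n : ℕ) : Type :=
  ⋀[X.functionField]^n (KaehlerDifferential ℂ X.functionField)

variable {X}

/-- The rational `n`-forms that are regular at `z`: the `𝒪_{X,z}`-span of the forms
`da₁ ∧ … ∧ daₙ` with `aᵢ ∈ 𝒪_{X,z}`, i.e. the image of `⋀ⁿ Ω_{𝒪_{X,z}/ℂ}`. -/
def regularFormsAt (n : ℕ) (z : X) :
    Submodule (algebraMap (X.presheaf.stalk z) X.functionField).range (RationalForm X n) :=
  Submodule.span _ (Set.range fun a : Fin n → X.presheaf.stalk z =>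
    exteriorPower.ιMulti X.functionField n
      fun i => KaehlerDifferential.D ℂ X.functionField (algebraMap _ X.functionField (a i)))

/-- The form `ω` vanishes at the point `z` (used at points of codimension one):
it is a multiple of a regular form by an element of the maximal ideal. -/
def HasZeroAt {n : ℕ} (ω : RationalForm X n) (z : X) : Prop :=
  ∃ a ∈ IsLocalRing.maximalIdeal (X.presheaf.stalk z), ∃ η ∈ regularFormsAt n z,
    ω = algebraMap (X.presheaf.stalk z) X.functionField a • η

/-- The order of the pole of `ω` at the point `z` (used at points of codimension one):
the least `k ≥ 0` such that `𝔪_z ^ k • ω` consists of regular forms. It is `0` if and only if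
`ω` is regular at `z`. -/
def poleOrder {n : ℕ} (ω : RationalForm X n) (z : X) : ℕ :=
  sInf {k : ℕ | ∀ a ∈ IsLocalRing.maximalIdeal (X.presheaf.stalk z) ^ k,
    algebraMap (X.presheaf.stalk z) X.functionField a • ω ∈ regularFormsAt n z}

end Forms

namespace CodimOneEmbedding

variable {n : ℕ} {X : Scheme.{0}} [X.Over SpecC] (j : CodimOneEmbedding n X)

instance nonempty_dom : Nonempty j.dom := by
  by_contra h
  have hg : genericPoint (torus n) ∉ j.dom := fun hg => h ⟨⟨_, hg⟩⟩
  have h0 : Order.coheight (genericPoint (torus n)) = 0 := by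
    rw [Order.coheight_eq_zero]
    intro y _
    exact (genericPoint_spec (torus n)).specializes trivial
  have := j.two_le_codim _ hg
  rw [h0] at this
  exact absurd this (by decide)

instance nonempty_image : Nonempty (j.hom ''ᵁ (⊤ : j.dom.toScheme.Opens)) :=
  ⟨⟨j.hom j.nonempty_dom.some, ⟨_, trivial, rfl⟩⟩⟩

/-- The coordinate `xᵢ` of the torus, regarded as a rational function on `X` through `j`. -/
def coord [IsIntegral X] (i : Fin n) : X.functionField :=
  X.germToFunctionField (j.hom ''ᵁ ⊤) ((j.hom.appIso ⊤).inv (j.dom.ι.appTop (torusCoord n i)))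

/-- The volume form `Ωₙ = dx₁/x₁ ∧ … ∧ dxₙ/xₙ` of the torus, regarded as a rational form
on `X` through `j`. -/
def volumeForm [IsIntegral X] : RationalForm X n :=
  exteriorPower.ιMulti X.functionField n
    fun i => (j.coord i)⁻¹ • KaehlerDifferential.D ℂ X.functionField (j.coord i)

end CodimOneEmbedding

/-! ### Cluster type pairs -/

open Classical in
/-- For an `n`-dimensional normal complex variety `X` and a Weil divisor `B` on `X`: the pair
`(X, B)` is of cluster type if there is an embedding in codimension one `𝔾ₘⁿ ⇢ X` such that
`Ωₙ` has no zeros (along prime divisors of `X`) and `B` is its divisor of poles.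
Prime divisors are represented by their generic points. -/
def IsClusterTypePair (n : ℕ) (X : Scheme.{0}) [X.Over SpecC] [IsIntegral X]
    (B : AlgebraicCycle X ℤ) : Prop :=
  ∃ j : CodimOneEmbedding n X,
    (∀ z : X, Order.coheight z = 1 → ¬ HasZeroAt j.volumeForm z) ∧
    ∀ z : X, B z = if Order.coheight z = 1 then (poleOrder j.volumeForm z : ℤ) else 0

/-- The support of a divisor: the union of the closures of the points with nonzero coefficient. -/
def divisorSupport {X : Scheme.{0}} (B : AlgebraicCycle X ℤ) : Set X :=
  ⋃ z ∈ {z : X | B z ≠ 0}, closure {z}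

/-- The complex points of `X^sm ∖ B`, with the Euclidean topology. -/
abbrev SmoothComplement (X : Scheme.{0}) [X.Over SpecC] [LocallyOfFiniteType (X ↘ SpecC)]
    (B : AlgebraicCycle X ℤ) : Type :=
  {p : ComplexPoints X // p.pt ∈ (X ↘ SpecC).smoothLocus ∧ p.pt ∉ divisorSupport B}

end ClusterType

end


/-!
An open subset of a space induces a surjection on fundamental groups as soon as, near each point
and in suitable local coordinates, it contains the complement of a complex hypersurface: paths can
be pushed off the hypersurface. A smooth point has étale coordinates, by the implicit function
theorem applied to a submersive presentation, and in these coordinates every nonempty Zariski open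
subset contains the complement of a hypersurface, because a nonzero function divides a nonzero
polynomial in the free variables. So `π₁(X^sm ∖ B)` is a quotient of the fundamental group of the
complement of `{f = g = 0}` in the complex torus, for some relatively prime polynomials `f` and `g`
vanishing on the closed set of codimension two that is removed from the torus.

That this last group is a quotient of `ℤⁿ` follows by induction on `n`. Eliminating the first
variable yields a nonzero polynomial `r` in the remaining ones that lies in the ideal `(f, g)`, so
the fundamental group of `ℂˣ × {r ≠ 0}` surjects onto the one sought. The factor `ℂˣ` contributes a
single generator. The other factor acts through a slice `x₁ = t`, and for a generic `t` that slice
contains the complement of `{r = k = 0}` in a torus of dimension `n - 1`, with `k` relatively prime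
to `r`, to which induction applies.
-/

noncomputable section

namespace ClusterType

open Set Topology

/-! ### Tame subsets -/

section Tame

variable {Y : Type*} [TopologicalSpace Y]

theorem homotopic_of_range_subset {D : Set Y} (hD : IsSimplyConnected D) {x y : Y} (p q : Path x y)
    (hp : range p ⊆ D) (hq : range q ⊆ D) : p.Homotopic q := by
  have := hD.simplyConnectedSpace
  let lift (r : Path x y) (hr : range r ⊆ D) :
      Path (⟨x, hr r.source_mem_range⟩ : D) ⟨y, hr r.target_mem_range⟩ :=
    { toFun t := ⟨r t, hr ⟨t, rfl⟩⟩
      continuous_toFun := by fun_prop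
      source' := by simp
      target' := by simp }
  exact (SimplyConnectedSpace.paths_homotopic (lift p hp) (lift q hq)).map
    ⟨Subtype.val, continuous_subtype_val⟩

/-- `C` is a core of `S` in `D`: an open, dense and path connected part of the simply connected
open set `D` which is contained in `S`. -/
structure IsCore (S C D : Set Y) : Prop where
  isOpen_ambient : IsOpen D
  isSimplyConnected : IsSimplyConnected D
  isOpen : IsOpen C
  isPathConnected : IsPathConnected C
  subset_ambient : C ⊆ D
  subset : C ⊆ S
  ambient_subset_closure : D ⊆ closure C

/-- A subset `S` of `Y` is tame if every point of `Y` has arbitrarily small neighbourhoods in which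
`S` has a core. An open tame subset carries the whole fundamental group of `Y`. -/
def IsTame (S : Set Y) : Prop := ∀ y : Y, ∀ N ∈ 𝓝 y, ∃ D ⊆ N, y ∈ D ∧ ∃ C, IsCore S C D

theorem IsTame.mono {S S' : Set Y} (h : IsTame S) (hS : S ⊆ S') : IsTame S' := fun y N hN =>
  let ⟨D, hDN, hy, C, hC⟩ := h y N hN
  ⟨D, hDN, hy, C, { hC with subset := hC.subset.trans hS }⟩

theorem IsCore.self {S D : Set Y} (hD : IsOpen D) (hD' : IsSimplyConnected D) (hDS : D ⊆ S) :
    IsCore S D D :=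
  ⟨hD, hD', hD, hD'.isPathConnected, le_rfl, hDS, subset_closure⟩

theorem IsTame.exists_isCore_self {S : Set Y} (hS : IsTame S) (hSo : IsOpen S) {a : Y}
    (ha : a ∈ S) : ∃ D, a ∈ D ∧ IsCore S D D :=
  let ⟨D, hDS, haD, _, hC⟩ := hS a S (hSo.mem_nhds ha)
  ⟨D, haD, .self hC.isOpen_ambient hC.isSimplyConnected hDS⟩

theorem IsTame.exists_homotopic_trans {S C C₀ D D₀ : Set Y} (hS : IsTame S) (hC : IsCore S C D)
    (hC₀ : IsCore S C₀ D₀) {y u : Y} (hy : y ∈ D₀) (hu : u ∈ C) (δ : Path y u)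
    (hδ : range δ ⊆ D) :
    ∃ v ∈ C₀, ∃ (ε : Path y v) (ζ : Path v u), range ε ⊆ D₀ ∧ range ζ ⊆ S ∧
      (ε.trans ζ).Homotopic δ := by
  have hyD : y ∈ D := hδ δ.source_mem_range
  obtain ⟨N, hN, hyN, C', hC'⟩ :=
    hS y (D ∩ D₀) ((hC.isOpen_ambient.inter hC₀.isOpen_ambient).mem_nhds ⟨hyD, hy⟩)
  obtain ⟨w, hwN, hwC⟩ := mem_closure_iff.1 (hC.ambient_subset_closure hyD) N hC'.isOpen_ambient hyN
  obtain ⟨v, ⟨hvN, hvC⟩, hvC₀⟩ := mem_closure_iff.1 (hC₀.ambient_subset_closure (hN hwN).2) (N ∩ C)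
    (hC'.isOpen_ambient.inter hC.isOpen) ⟨hwN, hwC⟩
  obtain ⟨ε, hε⟩ := hC'.isSimplyConnected.isPathConnected.joinedIn _ hyN _ hvN
  obtain ⟨ζ, hζ⟩ := hC.isPathConnected.joinedIn _ hvC _ hu
  rw [← range_subset_iff] at hε hζ
  refine ⟨v, hvC₀, ε, ζ, hε.trans (hN.trans inter_subset_right), hζ.trans hC.subset,
    homotopic_of_range_subset hC.isSimplyConnected _ _ ?_ hδ⟩
  rw [Path.trans_range]
  exact union_subset (hε.trans (hN.trans inter_subset_left)) (hζ.trans hC.subset_ambient)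

/-- A path `γ` is pushable into `S` if, after prolonging it inside any set with a core so that it
ends in that core, it is homotopic to a path in `S`. -/
def IsPushable (S : Set Y) {a b : Y} (γ : Path a b) : Prop :=
  ∀ ⦃C D : Set Y⦄, IsCore S C D → ∀ ⦃u : Y⦄, u ∈ C → ∀ δ : Path b u, range δ ⊆ D →
    ∃ p : Path a u, range p ⊆ S ∧ p.Homotopic (γ.trans δ)

theorem IsPushable.of_homotopic {S : Set Y} {a b : Y} {γ γ' : Path a b} (hγ : IsPushable S γ)
    (h : γ.Homotopic γ') : IsPushable S γ' := fun _ _ hC _ hu δ hδ =>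
  let ⟨p, hpS, hp⟩ := hγ hC hu δ hδ
  ⟨p, hpS, hp.trans (h.hcomp (.refl δ))⟩

theorem IsPushable.cast {S : Set Y} {a b a' b' : Y} {γ : Path a b} (hγ : IsPushable S γ)
    (ha : a' = a) (hb : b' = b) : IsPushable S (γ.cast ha hb) := by
  subst ha hb
  exact hγ

theorem IsTame.isPushable_refl {S : Set Y} (hS : IsTame S) (hSo : IsOpen S) {a : Y} (ha : a ∈ S) :
    IsPushable S (Path.refl a) := by
  intro C D hC u hu δ hδ
  obtain ⟨N, haN, hN⟩ := hS.exists_isCore_self hSo ha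
  obtain ⟨v, -, ε, ζ, hε, hζ, h⟩ := hS.exists_homotopic_trans hC hN haN hu δ hδ
  refine ⟨ε.trans ζ, ?_, h.trans ⟨(Path.Homotopy.reflTrans δ).symm⟩⟩
  rw [Path.trans_range]
  exact union_subset (hε.trans hN.subset) hζ

theorem IsTame.isPushable_trans {S C₀ D₀ : Set Y} (hS : IsTame S) (hC₀ : IsCore S C₀ D₀)
    {a b c : Y} {γ : Path a b} (hγ : IsPushable S γ) (γ' : Path b c) (hγ' : range γ' ⊆ D₀) :
    IsPushable S (γ.trans γ') := by
  intro C D hC u hu δ hδ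
  obtain ⟨v, hv, ε, ζ, hε, hζ, h⟩ :=
    hS.exists_homotopic_trans hC hC₀ (hγ' γ'.target_mem_range) hu δ hδ
  obtain ⟨p, hpS, hp⟩ := hγ hC₀ hv (γ'.trans ε)
    (by rw [Path.trans_range]; exact union_subset hγ' hε)
  refine ⟨p.trans ζ, by rw [Path.trans_range]; exact union_subset hpS hζ, ?_⟩
  rw [← Path.Homotopic.Quotient.eq] at *
  simp only [Path.Homotopic.Quotient.mk_trans, Path.Homotopic.Quotient.trans_assoc] at *
  rw [hp, ← h]
  simp only [Path.Homotopic.Quotient.trans_assoc]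

theorem IsTame.isPushable {S : Set Y} (hS : IsTame S) (hSo : IsOpen S) {a b : Y} (ha : a ∈ S)
    (γ : Path a b) : IsPushable S γ := by
  choose D _ hyD C hC using fun y => hS y univ Filter.univ_mem
  obtain ⟨τ, hτ0, hτmono, ⟨m, hm⟩, hτ⟩ := exists_monotone_Icc_subset_open_cover_unitInterval
    (c := fun y => γ ⁻¹' D y) (fun y => (hC y).isOpen_ambient.preimage γ.continuous)
    (fun t _ => mem_iUnion.2 ⟨γ t, hyD _⟩)
  have pushable_subpath : ∀ k, IsPushable S (γ.subpath 0 (τ k)) := by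
    intro k
    induction k with
    | zero =>
      rw [hτ0, Path.subpath_self]
      exact hS.isPushable_refl hSo (by simpa using ha)
    | succ k ih =>
      obtain ⟨y, hy⟩ := hτ k
      refine (hS.isPushable_trans (hC y) ih (γ.subpath (τ k) (τ (k + 1))) ?_).of_homotopic
        ⟨Path.Homotopy.subpathTransSubpath γ 0 (τ k) (τ (k + 1))⟩
      rw [Path.range_subpath_of_le _ _ _ (hτmono k.le_succ)]
      exact image_subset_iff.2 hy
  have h := pushable_subpath m
  rw [hm m le_rfl, Path.subpath_zero_one] at h
  exact h.cast γ.source.symm γ.target.symm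

theorem IsTame.exists_path_homotopic {S : Set Y} (hS : IsTame S) (hSo : IsOpen S)
    {a b : Y} (ha : a ∈ S) (hb : b ∈ S) (γ : Path a b) :
    ∃ p : Path a b, range p ⊆ S ∧ p.Homotopic γ := by
  obtain ⟨D, hbD, hD⟩ := hS.exists_isCore_self hSo hb
  obtain ⟨p, hpS, hp⟩ := hS.isPushable hSo ha γ hD hbD (Path.refl b) (by simpa using hbD)
  exact ⟨p, hpS, hp.trans ⟨Path.Homotopy.transRefl γ⟩⟩

theorem IsTame.pathConnectedSpace {S : Set Y} (hS : IsTame S) (h : IsPathConnected S) :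
    PathConnectedSpace Y := by
  obtain ⟨a, ha⟩ := h.nonempty
  have joined_base (y : Y) : Joined y a := by
    obtain ⟨D, -, hyD, C, hC⟩ := hS y univ Filter.univ_mem
    obtain ⟨u, hu⟩ := hC.isPathConnected.nonempty
    have hjoin := hC.isSimplyConnected.isPathConnected.joinedIn _ hyD _ (hC.subset_ambient hu)
    exact hjoin.joined.trans
      (h.joinedIn _ (hC.subset hu) _ ha).joined
  exact ⟨⟨a⟩, fun x y => (joined_base x).trans (joined_base y).symm⟩

theorem map_surjective_of_isTame {X : Type*} [TopologicalSpace X] (f : C(X, Y))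
    (hf : IsOpenEmbedding f) (hS : IsTame (range f)) (x : X) :
    Function.Surjective (FundamentalGroup.map f x) := by
  intro c
  induction c using Path.Homotopic.Quotient.ind with
  | mk γ =>
  obtain ⟨p, hp, hpγ⟩ := hS.exists_path_homotopic hf.isOpen_range ⟨x, rfl⟩ ⟨x, rfl⟩ γ
  choose q hq using range_subset_iff.1 hp
  have hqc : Continuous q :=
    hf.isInducing.continuous_iff.2 (p.continuous.congr fun t => (hq t).symm)
  let q' : Path x x := ⟨⟨q, hqc⟩, hf.injective (by simp [hq]), hf.injective (by simp [hq])⟩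
  have hmap : q'.map f.continuous = p := Path.ext (funext hq)
  refine ⟨Path.Homotopic.Quotient.mk q', ?_⟩
  change Path.Homotopic.Quotient.mk (q'.map f.continuous) = _
  rw [hmap]
  exact Path.Homotopic.Quotient.eq.2 hpγ

end Tame

/-! ### Fundamental groups which are quotients of lattices -/

section LatticeQuotient

/-- A group is a lattice quotient of rank `n` if it is a quotient of `ℤⁿ`. -/
def IsLatticeQuotient (n : ℕ) (G : Type*) [Group G] : Prop :=
  ∃ φ : Multiplicative (Fin n → ℤ) →* G, Function.Surjective φ

namespace IsLatticeQuotient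

variable {m n : ℕ} {G H K : Type*} [Group G] [Group H] [Group K]

theorem of_surjective (hG : IsLatticeQuotient n G) (f : G →* H) (hf : Function.Surjective f) :
    IsLatticeQuotient n H :=
  let ⟨φ, hφ⟩ := hG
  ⟨f.comp φ, hf.comp hφ⟩

theorem of_subsingleton [Subsingleton G] : IsLatticeQuotient 0 G :=
  ⟨1, fun _ => ⟨1, Subsingleton.elim _ _⟩⟩

theorem of_isCyclic [IsCyclic G] : IsLatticeQuotient 1 G := by
  obtain ⟨g, hg⟩ := IsCyclic.exists_zpow_surjective (G := G)
  refine ⟨(zpowersHom G g).comp (Pi.evalAddMonoidHom (fun _ : Fin 1 => ℤ) 0).toMultiplicative,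
    fun x => ?_⟩
  obtain ⟨k, rfl⟩ := hg x
  exact ⟨Multiplicative.ofAdd fun _ => k, rfl⟩

theorem of_commute (hG : IsLatticeQuotient m G) (hH : IsLatticeQuotient n H) (f : G →* K)
    (g : H →* K) (hfg : ∀ x y, Commute (f x) (g y)) (hK : ∀ z, ∃ x y, z = f x * g y) :
    IsLatticeQuotient (m + n) K := by
  obtain ⟨φ, hφ⟩ := hG
  obtain ⟨ψ, hψ⟩ := hH
  let split : Multiplicative (Fin (m + n) → ℤ) →*
      Multiplicative (Fin m → ℤ) × Multiplicative (Fin n → ℤ) :=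
    (LinearMap.funLeft ℤ ℤ (Fin.castAdd n)).toAddMonoidHom.toMultiplicative.prod
      (LinearMap.funLeft ℤ ℤ (Fin.natAdd m)).toAddMonoidHom.toMultiplicative
  refine ⟨((f.comp φ).noncommCoprod (g.comp ψ) fun _ _ => hfg _ _).comp split, fun z => ?_⟩
  obtain ⟨x, y, rfl⟩ := hK z
  obtain ⟨a, rfl⟩ := hφ x
  obtain ⟨b, rfl⟩ := hψ y
  have hsplit : split (.ofAdd (Fin.append a.toAdd b.toAdd)) = (a, b) :=
    Prod.ext (funext (Fin.append_left a.toAdd b.toAdd)) (funext (Fin.append_right a.toAdd b.toAdd))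
  exact ⟨.ofAdd (Fin.append a.toAdd b.toAdd), by
    rw [MonoidHom.comp_apply, hsplit, MonoidHom.noncommCoprod_apply]; rfl⟩

theorem mul_comm (hG : IsLatticeQuotient n G) (a b : G) : a * b = b * a := by
  obtain ⟨φ, hφ⟩ := hG
  obtain ⟨a, rfl⟩ := hφ a
  obtain ⟨b, rfl⟩ := hφ b
  rw [← map_mul, _root_.mul_comm, map_mul]

theorem closure_range_ofAdd_single :
    Subgroup.closure (range fun i : Fin n => Multiplicative.ofAdd (Pi.single i (1 : ℤ))) = ⊤ := by
  refine top_le_iff.1 fun x _ => ?_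
  have hx : x = ∏ i, Multiplicative.ofAdd (Pi.single i (1 : ℤ)) ^ x.toAdd i := by
    apply Multiplicative.toAdd.injective
    ext k
    simp [Finset.sum_apply, Pi.single_apply]
  rw [hx]
  exact Subgroup.prod_mem _ fun i _ =>
    Subgroup.zpow_mem _ (Subgroup.subset_closure (mem_range_self i)) _

theorem fg_and_rank_le (hG : IsLatticeQuotient n G) : ∃ _ : Group.FG G, Group.rank G ≤ n := by
  classical
  obtain ⟨φ, hφ⟩ := hG
  let S : Finset (Multiplicative (Fin n → ℤ)) :=
    Finset.univ.image fun i => Multiplicative.ofAdd (Pi.single i 1)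
  have hS : Subgroup.closure (S : Set (Multiplicative (Fin n → ℤ))) = ⊤ := by
    simpa [S] using closure_range_ofAdd_single
  have : Group.FG (Multiplicative (Fin n → ℤ)) := ⟨⟨S, hS⟩⟩
  have := Group.fg_of_surjective hφ
  exact ⟨this, (Group.rank_le_of_surjective φ hφ).trans
    ((Group.rank_le hS).trans (Finset.card_image_le.trans (by simp)))⟩

end IsLatticeQuotient

variable {X Y : Type*} [TopologicalSpace X] [TopologicalSpace Y]

/-- A space has lattice fundamental group of rank `n` if it is path connected and its fundamental
groups are quotients of `ℤⁿ`. -/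
structure HasLatticeFundamentalGroup (n : ℕ) (Y : Type*) [TopologicalSpace Y] : Prop where
  pathConnectedSpace : PathConnectedSpace Y
  isLatticeQuotient (y : Y) : IsLatticeQuotient n (FundamentalGroup Y y)

namespace HasLatticeFundamentalGroup

theorem of_basepoint [PathConnectedSpace Y] {n : ℕ} (y : Y)
    (h : IsLatticeQuotient n (FundamentalGroup Y y)) : HasLatticeFundamentalGroup n Y :=
  ⟨inferInstance, fun y' =>
    let e := FundamentalGroup.fundamentalGroupMulEquivOfPathConnected y y'
    h.of_surjective e.toMonoidHom e.surjective⟩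

theorem of_simplyConnectedSpace [SimplyConnectedSpace Y] : HasLatticeFundamentalGroup 0 Y :=
  ⟨inferInstance, fun _ => .of_subsingleton⟩

theorem of_isTame {n : ℕ} (h : HasLatticeFundamentalGroup n X) (f : C(X, Y))
    (hf : IsOpenEmbedding f) (hS : IsTame (range f)) : HasLatticeFundamentalGroup n Y := by
  have := h.pathConnectedSpace
  have := hS.pathConnectedSpace (isPathConnected_range f.continuous)
  obtain ⟨x⟩ := PathConnectedSpace.nonempty (X := X)
  exact .of_basepoint (f x) ((h.isLatticeQuotient x).of_surjective _
    (map_surjective_of_isTame f hf hS x))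

theorem punctured_complex : HasLatticeFundamentalGroup 1 {z : ℂ // z ≠ 0} := by
  have cover := Complex.isAddQuotientCoveringMap_exp
  have := cover.surjective.pathConnectedSpace cover.continuous
  let e := cover.fundamentalGroupEquiv ⟨0, rfl⟩
  let i := MulOpposite.opMulEquiv
    (M := Multiplicative (AddSubgroup.zmultiples (2 * Real.pi * Complex.I)))
  exact .of_basepoint _ (IsLatticeQuotient.of_isCyclic.of_surjective (i.trans e.symm).toMonoidHom
    (i.trans e.symm).surjective)

end HasLatticeFundamentalGroup

variable (a : X) (b : Y)

/-- The homomorphism of fundamental groups induced by the slice `X × {b}`. -/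
def inclLeft : FundamentalGroup X a →* FundamentalGroup (X × Y) (a, b) :=
  FundamentalGroup.map (Y := X × Y) ⟨fun x => (x, b), by fun_prop⟩ a

/-- The homomorphism of fundamental groups induced by the slice `{a} × Y`. -/
def inclRight : FundamentalGroup Y b →* FundamentalGroup (X × Y) (a, b) :=
  FundamentalGroup.map (Y := X × Y) ⟨fun y => (a, y), by fun_prop⟩ b

theorem inclLeft_apply (α : FundamentalGroup X a) :
    inclLeft a b α = Path.Homotopic.prod α (Path.Homotopic.Quotient.refl b) := by
  induction α using Path.Homotopic.Quotient.ind
  rfl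

theorem inclRight_apply (β : FundamentalGroup Y b) :
    inclRight a b β = Path.Homotopic.prod (Path.Homotopic.Quotient.refl a) β := by
  induction β using Path.Homotopic.Quotient.ind
  rfl

theorem commute_inclLeft_inclRight (α : FundamentalGroup X a) (β : FundamentalGroup Y b) :
    Commute (inclLeft a b α) (inclRight a b β) := by
  rw [inclLeft_apply, inclRight_apply, commute_iff_eq, FundamentalGroup.mul_def,
    FundamentalGroup.mul_def, Path.Homotopic.comp_prod_eq_prod_comp,
    Path.Homotopic.comp_prod_eq_prod_comp]
  simp

theorem exists_eq_inclLeft_mul_inclRight (c : FundamentalGroup (X × Y) (a, b)) :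
    ∃ α β, c = inclLeft a b α * inclRight a b β := by
  refine ⟨Path.Homotopic.projLeft c, Path.Homotopic.projRight c, ?_⟩
  rw [inclLeft_apply, inclRight_apply, FundamentalGroup.mul_def,
    Path.Homotopic.comp_prod_eq_prod_comp]
  simp

theorem mapOfEq_map_eq_map_inclRight {V W Z : Type*} [TopologicalSpace V] [TopologicalSpace W]
    [TopologicalSpace Z] (i : C(W, V)) (s : C(V, Z)) (e : C(X × W, Z))
    (h : ∀ w, s (i w) = e (a, w)) (w : W) (β : FundamentalGroup W w) :
    FundamentalGroup.mapOfEq s (h w) (FundamentalGroup.map i w β) =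
      FundamentalGroup.map e (a, w) (inclRight a w β) := by
  rw [FundamentalGroup.mapOfEq_apply]
  induction β using Path.Homotopic.Quotient.ind with
  | mk γ => exact congrArg Path.Homotopic.Quotient.mk (Path.ext (funext fun t => h (γ t)))

theorem HasLatticeFundamentalGroup.of_slice {A W V : Type*} [TopologicalSpace A]
    [TopologicalSpace W] [TopologicalSpace V] {m n : ℕ} (hA : HasLatticeFundamentalGroup m A)
    (hV : HasLatticeFundamentalGroup n V) [PathConnectedSpace Y] (i : C(W, V)) (e : C(A × W, Y))
    (s : C(V, Y)) (a : A) (w : W) (hi : Function.Surjective (FundamentalGroup.map i w))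
    (he : Function.Surjective (FundamentalGroup.map e (a, w)))
    (hs : ∀ w', s (i w') = e (a, w')) : HasLatticeFundamentalGroup (m + n) Y := by
  have hg := mapOfEq_map_eq_map_inclRight a i s e hs w
  refine .of_basepoint _ ((hA.isLatticeQuotient a).of_commute (hV.isLatticeQuotient (i w))
    ((FundamentalGroup.map e (a, w)).comp (inclLeft a w)) (FundamentalGroup.mapOfEq s (hs w))
    (fun α v => ?_) fun c => ?_)
  · obtain ⟨β, rfl⟩ := hi v
    rw [hg]
    exact (commute_inclLeft_inclRight a w α β).map (FundamentalGroup.map e (a, w))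
  · obtain ⟨c, rfl⟩ := he c
    obtain ⟨α, β, rfl⟩ := exists_eq_inclLeft_mul_inclRight a w c
    exact ⟨α, FundamentalGroup.map i w β, by rw [hg, map_mul, MonoidHom.comp_apply]⟩

end LatticeQuotient

/-! ### Complements of hypersurfaces -/

section CountableComplement

open scoped Convex

variable {E : Type*} [AddCommGroup E] [Module ℝ E]

theorem countable_setOf_segment_inter_nonempty {s : Set E} (hs : s.Countable) {c x y : E}
    (hx : c + x ∉ s) (hxy : LinearIndependent ℝ ![x, y]) :
    {t : ℝ | ([c + x -[ℝ] c + t • y] ∩ s).Nonempty}.Countable := by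
  refine countable_ofPred_nonempty_of_disjoint (fun t t' htt' => ?_)
    (fun _ => inter_subset_right) hs
  rw [Function.onFun, disjoint_iff_inter_eq_empty, ← inter_inter_distrib_right,
    segment_inter_eq_endpoint_of_linearIndependent_of_ne hxy htt'.symm]
  exact singleton_inter_eq_empty.2 hx

variable [TopologicalSpace E] [ContinuousAdd E] [ContinuousSMul ℝ E]

theorem isPathConnected_diff_of_countable (hE : 1 < Module.rank ℝ E) {U s : Set E}
    (hU : IsOpen U) (hconv : Convex ℝ U) (hne : U.Nonempty) (hs : s.Countable) :
    IsPathConnected (U \ s) := by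
  have : Nontrivial E := (rank_pos_iff_nontrivial (R := ℝ)).1 (zero_lt_one.trans hE)
  refine isPathConnected_iff.2 ⟨(hs.dense_compl ℝ).inter_open_nonempty U hU hne, ?_⟩
  rintro a ⟨haU, ha⟩ b ⟨hbU, hb⟩
  rcases eq_or_ne a b with rfl | hab
  · exact JoinedIn.refl ⟨haU, ha⟩
  obtain ⟨c, x, rfl, rfl⟩ : ∃ c x, a = c + x ∧ b = c + -x :=
    ⟨(2 : ℝ)⁻¹ • (a + b), (2 : ℝ)⁻¹ • (a - b), by module, by module⟩
  have hx : x ≠ 0 := by rintro rfl; simp at hab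
  obtain ⟨y, hxy⟩ := exists_linearIndependent_pair_of_one_lt_rank hE hx
  have hxy' : LinearIndependent ℝ ![-x, y] := by
    convert! hxy.units_smul ![-1, 1]
    simp [← List.ofFn_inj]
  have hcU : c ∈ U := by
    convert hconv.midpoint_mem haU hbU using 1
    rw [midpoint_eq_smul_add, invOf_eq_inv]
    module
  have hopen : IsOpen ((fun t : ℝ => c + t • y) ⁻¹' U) := hU.preimage (by fun_prop)
  have hbad := (countable_setOf_segment_inter_nonempty hs ha hxy).union
    (countable_setOf_segment_inter_nonempty hs hb hxy')
  obtain ⟨t, htU, ht⟩ := (hbad.dense_compl ℝ).inter_open_nonempty _ hopen ⟨0, by simpa using hcU⟩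
  obtain ⟨hta, htb⟩ := not_or.1 ht
  have joined {z : E} (hzU : z ∈ U) (hz : ¬([z -[ℝ] c + t • y] ∩ s).Nonempty) :
      JoinedIn (U \ s) z (c + t • y) :=
    .of_segment_subset fun w hw => ⟨hconv.segment_subset hzU htU hw, fun hws => hz ⟨w, hw, hws⟩⟩
  exact (joined haU hta).trans (joined hbU htb).symm

end CountableComplement

section HypersurfaceComplement

variable {κ : Type*}

theorem isOpen_setOf_eval_ne_zero {R : Type*} [CommRing R] [TopologicalSpace R]
    [IsTopologicalRing R] [T1Space R] (p : MvPolynomial κ R) :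
    IsOpen {x | MvPolynomial.eval x p ≠ 0} :=
  isOpen_compl_singleton.preimage (MvPolynomial.continuous_eval p)

theorem exists_polynomial_eval_lineMap {R : Type*} [CommRing R] (p : MvPolynomial κ R)
    (a b : κ → R) : ∃ q : Polynomial R,
      ∀ z, q.eval z = MvPolynomial.eval (AffineMap.lineMap a b z) p := by
  refine ⟨p.aeval fun i => Polynomial.C (a i) + Polynomial.X * Polynomial.C (b i - a i),
    fun z => ?_⟩
  rw [MvPolynomial.aeval_def, MvPolynomial.polynomial_eval_eval₂, MvPolynomial.eval,
    MvPolynomial.coe_eval₂Hom]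
  congr 1
  · ext
    simp
  · ext i
    simp [AffineMap.lineMap_apply, add_comm]

variable [Finite κ] {p : MvPolynomial κ ℂ} {D : Set (κ → ℂ)}

theorem exists_mem_eval_ne_zero_of_isOpen (hp : p ≠ 0) (hD : IsOpen D) (hne : D.Nonempty) :
    ∃ x ∈ D, MvPolynomial.eval x p ≠ 0 := by
  have := Fintype.ofFinite κ
  by_contra! h
  obtain ⟨x, hx⟩ := hne
  obtain ⟨ε, hε, hsub⟩ := Metric.isOpen_iff.1 hD x hx
  refine hp (MvPolynomial.funext_set (fun i => Metric.ball (x i) ε) (fun i => ?_) fun y hy => ?_)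
  · exact infinite_of_mem_nhds (x i) (Metric.ball_mem_nhds _ hε)
  · rw [map_zero]
    exact h y (hsub ((ball_pi x hε).symm ▸ hy))

theorem subset_closure_inter_eval_ne_zero (hp : p ≠ 0) (hD : IsOpen D) :
    D ⊆ closure (D ∩ {x | MvPolynomial.eval x p ≠ 0}) := fun x hx =>
  mem_closure_iff.2 fun _ ho hxo =>
    let ⟨y, hy, hy'⟩ := exists_mem_eval_ne_zero_of_isOpen hp (ho.inter hD) ⟨x, hxo, hx⟩
    ⟨y, hy.1, hy.2, hy'⟩

theorem isPathConnected_inter_eval_ne_zero (hp : p ≠ 0) (hD : IsOpen D) (hc : Convex ℝ D)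
    (hne : D.Nonempty) :
    IsPathConnected (D ∩ {x | MvPolynomial.eval x p ≠ 0}) := by
  refine isPathConnected_iff.2 ⟨exists_mem_eval_ne_zero_of_isOpen hp hD hne, ?_⟩
  rintro a ⟨haD, ha⟩ b ⟨hbD, hb⟩
  obtain ⟨q, hq⟩ := exists_polynomial_eval_lineMap p a b
  let L : ℂ →ᵃ[ℂ] κ → ℂ := AffineMap.lineMap a b
  have hL : Continuous L := AffineMap.lineMap_continuous
  have h0 : q.eval 0 ≠ 0 := by rwa [hq, AffineMap.lineMap_apply_zero]
  have h1 : q.eval 1 ≠ 0 := by rwa [hq, AffineMap.lineMap_apply_one]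
  have hroots : {z | q.IsRoot z}.Countable :=
    (Polynomial.finite_setOfPred_isRoot fun h => by simp [h] at h0).countable
  have hline : IsPathConnected (L ⁻¹' D \ {z | q.IsRoot z}) :=
    isPathConnected_diff_of_countable (by simp) (hD.preimage hL)
      ((hc.translate_preimage_left a).linear_preimage
        ((LinearMap.toSpanSingleton ℂ _ (b - a)).restrictScalars ℝ))
      ⟨0, by simpa [L] using haD⟩ hroots
  have hjoin := (hline.joinedIn 0 ⟨by simpa [L] using haD, h0⟩ 1
    ⟨by simpa [L] using hbD, h1⟩).map hL
  rw [AffineMap.lineMap_apply_zero, AffineMap.lineMap_apply_one] at hjoin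
  exact hjoin.mono (image_subset_iff.2 fun z hz => ⟨hz.1, (hq z).symm.trans_ne hz.2⟩)

end HypersurfaceComplement

section Charts

variable {Y : Type*} [TopologicalSpace Y] {κ : Type*} [Finite κ] {p : MvPolynomial κ ℂ} {S : Set Y}

theorem isSimplyConnected_symm_image {E : Type*} [AddCommGroup E] [Module ℝ E]
    [TopologicalSpace E] [ContinuousAdd E] [ContinuousSMul ℝ E] (e : OpenPartialHomeomorph Y E)
    {B : Set E} (hB : Convex ℝ B) (hne : B.Nonempty) (hBt : B ⊆ e.target) :
    IsSimplyConnected (e.symm '' B) := by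
  have : ContractibleSpace B := hB.contractibleSpace hne
  exact (e.symm.homeomorphOfImageSubsetSource hBt rfl).symm.toHomotopyEquiv.simplyConnectedSpace

theorem isCore_symm_image (hp : p ≠ 0) (e : OpenPartialHomeomorph Y (κ → ℂ))
    (hS : ∀ x ∈ e.source, MvPolynomial.eval (e x) p ≠ 0 → x ∈ S) {B : Set (κ → ℂ)}
    (hBo : IsOpen B) (hB : Convex ℝ B) (hne : B.Nonempty) (hBt : B ⊆ e.target) :
    IsCore S (e.symm '' (B ∩ {x | MvPolynomial.eval x p ≠ 0})) (e.symm '' B) where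
  isOpen_ambient := e.symm.isOpen_image_of_subset_source hBo hBt
  isSimplyConnected := isSimplyConnected_symm_image e hB hne hBt
  isOpen := e.symm.isOpen_image_of_subset_source (hBo.inter (isOpen_setOf_eval_ne_zero p))
    (inter_subset_left.trans hBt)
  isPathConnected := (isPathConnected_inter_eval_ne_zero hp hBo hB hne).image'
    (e.continuousOn_symm.mono (inter_subset_left.trans hBt))
  subset_ambient := image_mono inter_subset_left
  subset := by
    rintro _ ⟨x, ⟨hx, hpx⟩, rfl⟩
    exact hS _ (e.map_target (hBt hx)) (by rwa [e.right_inv (hBt hx)])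
  ambient_subset_closure := by
    rintro _ ⟨x, hx, rfl⟩
    exact ((e.continuousOn_symm x (hBt hx)).mono (inter_subset_left.trans hBt)).mem_closure_image
      (subset_closure_inter_eval_ne_zero hp hBo hx)

theorem isTame_of_charts (h : ∀ y : Y, ∃ (κ : Type) (_ : Finite κ)
      (e : OpenPartialHomeomorph Y (κ → ℂ)) (p : MvPolynomial κ ℂ), y ∈ e.source ∧ p ≠ 0 ∧
        ∀ x ∈ e.source, MvPolynomial.eval (e x) p ≠ 0 → x ∈ S) : IsTame S := by
  intro y N hN
  obtain ⟨κ, _, e, p, hy, hp, hS⟩ := h y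
  have := Fintype.ofFinite κ
  have hmem : e.target ∩ e.symm ⁻¹' N ∈ 𝓝 (e y) := by
    refine Filter.inter_mem (e.open_target.mem_nhds (e.map_source hy))
      ((e.continuousAt_symm (e.map_source hy)).preimage_mem_nhds ?_)
    rwa [e.left_inv hy]
  obtain ⟨r, hr, hsub⟩ := Metric.mem_nhds_iff.1 hmem
  have hball := Metric.mem_ball_self (x := e y) hr
  exact ⟨e.symm '' Metric.ball (e y) r, image_subset_iff.2 fun x hx => (hsub hx).2,
    ⟨e y, hball, e.left_inv hy⟩, _, isCore_symm_image hp e hS Metric.isOpen_ball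
      (convex_ball _ _) ⟨_, hball⟩ fun x hx => (hsub hx).1⟩

theorem isTame_setOf_eval_ne_zero {κ : Type} [Finite κ] {O : Set (κ → ℂ)} (hO : IsOpen O)
    {p : MvPolynomial κ ℂ} (hp : p ≠ 0) :
    IsTame {y : O | MvPolynomial.eval (y : κ → ℂ) p ≠ 0} := by
  refine isTame_of_charts fun y => ?_
  have : Nonempty O := ⟨y⟩
  exact ⟨κ, inferInstance, hO.isOpenEmbedding_subtypeVal.toOpenPartialHomeomorph _, p,
    trivial, hp, fun _ _ hx => hx⟩

end Charts

/-! ### Elimination of a variable -/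

section Elimination

open Polynomial

section Localization

variable {A S : Type*} [CommRing A] [CommRing S] [Algebra A S]

theorem exists_mem_dvd_mul_of_algebraMap_dvd (M : Submonoid A) [IsLocalization M S] {a b : A}
    (h : algebraMap A S a ∣ algebraMap A S b) : ∃ m ∈ M, a ∣ m * b := by
  rw [← Ideal.mem_span_singleton, ← Set.image_singleton, ← Ideal.map_span,
    IsLocalization.algebraMap_mem_map_algebraMap_iff M] at h
  simpa only [Ideal.mem_span_singleton] using h

theorem isRelPrime_algebraMap_of_isLocalization [GCDMonoid A] (M : Submonoid A)
    [IsLocalization M S] {f g : A} (h : IsRelPrime f g) :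
    IsRelPrime (algebraMap A S f) (algebraMap A S g) := by
  intro d hdf hdg
  obtain ⟨a, s, rfl⟩ := IsLocalization.exists_mk'_eq M d
  have ha : algebraMap A S a ∣ IsLocalization.mk' S a s :=
    ⟨_, IsLocalization.mk'_eq_mul_mk'_one a s⟩
  obtain ⟨m, hm, hmf⟩ := exists_mem_dvd_mul_of_algebraMap_dvd M (ha.trans hdf)
  obtain ⟨k, hk, hkg⟩ := exists_mem_dvd_mul_of_algebraMap_dvd M (ha.trans hdg)
  have hgcd : a ∣ gcd (m * k * f) (m * k * g) :=
    dvd_gcd (hmf.trans ⟨k, by ring⟩) (hkg.trans ⟨m, by ring⟩)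
  have hak : a ∣ m * k := (hgcd.trans (gcd_mul_left' _ _ _).dvd).trans
    (associated_mul_unit_left _ _ (gcd_isUnit_iff_isRelPrime.2 h)).dvd
  exact isUnit_of_dvd_unit ((Dvd.intro _ (IsLocalization.mk'_spec S a s)).trans (map_dvd _ hak))
    (IsLocalization.map_units S (⟨m * k, M.mul_mem hm hk⟩ : M))

end Localization

attribute [local instance] Polynomial.algebra Polynomial.isLocalization in
theorem exists_C_mem_span_of_isRelPrime {R : Type*} [CommRing R] [IsDomain R]
    [UniqueFactorizationMonoid R] {F G : R[X]} (h : IsRelPrime F G) :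
    ∃ r : R, r ≠ 0 ∧ C r ∈ Ideal.span {F, G} := by
  classical
  have := Classical.choice (inferInstance : Nonempty (NormalizedGCDMonoid R[X]))
  let K := FractionRing R
  let M := (nonZeroDivisors R).map C
  have hcop : IsCoprime (algebraMap R[X] K[X] F) (algebraMap R[X] K[X] G) :=
    (isRelPrime_algebraMap_of_isLocalization M h).isCoprime
  have hone : algebraMap R[X] K[X] 1 ∈ (Ideal.span {F, G}).map (algebraMap R[X] K[X]) := by
    rw [map_one, Ideal.map_span, Set.image_pair]
    exact Ideal.mem_span_pair.2 hcop
  obtain ⟨_, ⟨r, hr, rfl⟩, hmem⟩ :=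
    (IsLocalization.algebraMap_mem_map_algebraMap_iff M _ _ _).1 hone
  exact ⟨r, nonZeroDivisors.ne_zero hr, by simpa using hmem⟩

theorem finite_setOf_exists_prime_dvd {ι R : Type*} [CommRing R] [IsDomain R]
    [UniqueFactorizationMonoid R] {r : R} (hr : r ≠ 0) (s : ι → Set R)
    (h : ∀ q, Prime q → q ∣ r → {t | ∀ x ∈ s t, q ∣ x}.Finite) :
    {t | ∃ q, Prime q ∧ q ∣ r ∧ ∀ x ∈ s t, q ∣ x}.Finite := by
  classical
  refine ((UniqueFactorizationMonoid.factors r).toFinset.finite_toSet.biUnion fun q hq => ?_).subset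
    (fun t ht => ?_) (s := ⋃ q ∈ _, {t | ∀ x ∈ s t, q ∣ x})
  · rw [Finset.mem_coe, Multiset.mem_toFinset] at hq
    exact h q (UniqueFactorizationMonoid.prime_of_factor q hq)
      (UniqueFactorizationMonoid.dvd_of_mem_factors hq)
  · obtain ⟨q, hq, hqr, hqt⟩ := ht
    obtain ⟨q', hq', hass⟩ :=
      UniqueFactorizationMonoid.exists_mem_factors_of_dvd hr hq.irreducible hqr
    exact mem_biUnion (Multiset.mem_toFinset.2 hq') fun x hx => hass.symm.dvd.trans (hqt x hx)

variable {k R : Type*} [Field k] [CommRing R] [Algebra k R]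

theorem finite_setOf_dvd_eval {q : R} (hq : Prime q) {F : R[X]} (hF : ¬ C q ∣ F) :
    {t : k | q ∣ F.eval (algebraMap k R t)}.Finite := by
  have hprime : (Ideal.span {q}).IsPrime := (Ideal.span_singleton_prime hq.ne_zero).2 hq
  let π := Ideal.Quotient.mk (Ideal.span {q})
  have hne : F.map π ≠ 0 := fun h0 => hF <| (C_dvd_iff_dvd_coeff _ _).2 fun i => by
    rw [← Ideal.mem_span_singleton, ← Ideal.Quotient.eq_zero_iff_mem, ← coeff_map π, h0, coeff_zero]
  refine Set.Finite.of_finite_image (f := π.comp (algebraMap k R)) ?_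
    (RingHom.injective _).injOn
  refine (finite_setOfPred_isRoot hne).subset ?_
  rintro _ ⟨t, ht, rfl⟩
  rw [mem_ofPred_eq, IsRoot, RingHom.comp_apply, eval_map_apply]
  exact Ideal.Quotient.eq_zero_iff_mem.2 (Ideal.mem_span_singleton.2 ht)

theorem finite_setOf_dvd_add_mul {q a b : R} (hq : Prime q) (h : ¬ (q ∣ a ∧ q ∣ b)) :
    {c : k | q ∣ a + b * algebraMap k R c}.Finite := by
  have hdvd : ¬ C q ∣ C a + C b * X := fun hd =>
    h ⟨by simpa using (C_dvd_iff_dvd_coeff _ _).1 hd 0, by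
      simpa using (C_dvd_iff_dvd_coeff _ _).1 hd 1⟩
  simpa using finite_setOf_dvd_eval (k := k) hq hdvd

variable [IsDomain R] [UniqueFactorizationMonoid R]

theorem finite_setOf_exists_prime_dvd_eval {r : R} (hr : r ≠ 0) {F G : R[X]}
    (h : IsRelPrime F G) : {t : k | ∃ q, Prime q ∧ q ∣ r ∧
      q ∣ F.eval (algebraMap k R t) ∧ q ∣ G.eval (algebraMap k R t)}.Finite := by
  have hfin := finite_setOf_exists_prime_dvd hr
    (fun t : k => {F.eval (algebraMap k R t), G.eval (algebraMap k R t)}) fun q hq _ => ?_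
  · simpa using hfin
  · by_cases hF : C q ∣ F
    · have hG : ¬ C q ∣ G := fun hG => hq.not_isUnit (isUnit_C.1 (h hF hG))
      exact (finite_setOf_dvd_eval hq hG).subset fun t ht => ht _ (by simp)
    · exact (finite_setOf_dvd_eval hq hF).subset fun t ht => ht _ (by simp)

theorem exists_isRelPrime_add_mul [Infinite k] {r a b : R} (hr : r ≠ 0)
    (h : ∀ q, Prime q → q ∣ r → ¬ (q ∣ a ∧ q ∣ b)) :
    ∃ c : k, IsRelPrime r (a + b * algebraMap k R c) := by
  have hfin := finite_setOf_exists_prime_dvd hr (fun c : k => {a + b * algebraMap k R c})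
    fun q hq hqr => by simpa using finite_setOf_dvd_add_mul hq (h q hq hqr)
  obtain ⟨c, hc⟩ := hfin.exists_notMem
  refine ⟨c, (UniqueFactorizationMonoid.isRelPrime_iff_no_prime_factors hr).2
    fun q hqr hqx hq => ?_⟩
  exact hc ⟨q, hq, hqr, by simpa using hqx⟩

theorem exists_ne_zero_isRelPrime_eval_add_mul [Infinite k] {r : R} (hr : r ≠ 0) {F G : R[X]}
    (h : IsRelPrime F G) : ∃ t c : k, t ≠ 0 ∧
      IsRelPrime r (F.eval (algebraMap k R t) + G.eval (algebraMap k R t) * algebraMap k R c) := by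
  obtain ⟨t, ht⟩ := ((finite_setOf_exists_prime_dvd_eval (k := k) hr h).insert 0).exists_notMem
  obtain ⟨ht0, ht⟩ := not_or.1 ht
  obtain ⟨c, hc⟩ := exists_isRelPrime_add_mul (k := k) hr fun q hq hqr hdvd => ht ⟨q, hq, hqr, hdvd⟩
  exact ⟨t, c, ht0, hc⟩

end Elimination

/-! ### Complements of codimension two in the torus -/

section TorusCompl

variable {n : ℕ}

theorem eval_cons {R : Type*} [CommRing R] (f : MvPolynomial (Fin (n + 1)) R) (t : R)
    (v : Fin n → R) : MvPolynomial.eval (Fin.cons t v : Fin (n + 1) → R) f = MvPolynomial.eval v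
      ((MvPolynomial.finSuccEquiv R n f).eval (algebraMap R (MvPolynomial (Fin n) R) t)) := by
  rw [MvPolynomial.eval_eq_eval_mv_eval', Polynomial.eval_map, Polynomial.eval,
    Polynomial.hom_eval₂, MvPolynomial.algebraMap_eq, MvPolynomial.eval_C, RingHom.comp_id]

theorem isRelPrime_finSuccEquiv {R : Type*} [CommRing R] {f g : MvPolynomial (Fin (n + 1)) R}
    (h : IsRelPrime f g) :
    IsRelPrime (MvPolynomial.finSuccEquiv R n f) (MvPolynomial.finSuccEquiv R n g) := by
  intro d hf hg
  let E := MvPolynomial.finSuccEquiv R n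
  have hd : IsUnit (E.symm d) :=
    h (by simpa [E] using map_dvd E.symm hf) (by simpa [E] using map_dvd E.symm hg)
  simpa using hd.map E

/-- The complement in the complex torus of the common zeros of two polynomials. -/
def torusCompl (f g : MvPolynomial (Fin n) ℂ) : Set (Fin n → ℂ) :=
  {x | (∀ i, x i ≠ 0) ∧ (MvPolynomial.eval x f ≠ 0 ∨ MvPolynomial.eval x g ≠ 0)}

theorem isOpen_torusCompl (f g : MvPolynomial (Fin n) ℂ) : IsOpen (torusCompl f g) := by
  have htorus : IsOpen {x : Fin n → ℂ | ∀ i, x i ≠ 0} := by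
    rw [Set.ofPred_forall]
    exact isOpen_iInter_of_finite fun i => isOpen_ne_fun (continuous_apply i) continuous_const
  exact htorus.inter ((isOpen_setOf_eval_ne_zero f).union (isOpen_setOf_eval_ne_zero g))

theorem torusCompl_zero_subset (r k : MvPolynomial (Fin n) ℂ) :
    torusCompl r 0 ⊆ torusCompl r k := fun x hx => ⟨hx.1, .inl (by simpa using hx.2)⟩

theorem isPathConnected_torusCompl_zero {r : MvPolynomial (Fin n) ℂ} (hr : r ≠ 0) :
    IsPathConnected (torusCompl r 0) := by
  have hcompl : torusCompl r 0 =
      univ ∩ {x | MvPolynomial.eval x (r * ∏ i, MvPolynomial.X i) ≠ 0} := by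
    ext x
    simp [torusCompl, Finset.prod_eq_zero_iff, and_comm]
  rw [hcompl]
  exact isPathConnected_inter_eval_ne_zero
    (mul_ne_zero hr (Finset.prod_ne_zero_iff.2 fun i _ => MvPolynomial.X_ne_zero i))
    isOpen_univ convex_univ univ_nonempty

theorem torusCompl_nonempty_of_isRelPrime {f g : MvPolynomial (Fin 0) ℂ} (h : IsRelPrime f g) :
    (torusCompl f g).Nonempty := by
  by_contra hne
  have hz (x : Fin 0 → ℂ) : MvPolynomial.eval x f = 0 ∧ MvPolynomial.eval x g = 0 := by
    by_contra hx
    exact hne ⟨x, fun i => i.elim0, by tauto⟩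
  obtain rfl : f = 0 := MvPolynomial.funext fun x => by rw [(hz x).1, map_zero]
  obtain rfl : g = 0 := MvPolynomial.funext fun x => by rw [(hz x).2, map_zero]
  exact not_isUnit_zero (h dvd_rfl dvd_rfl)

theorem cons_mem_torusCompl {f g : MvPolynomial (Fin (n + 1)) ℂ}
    {h : Polynomial (MvPolynomial (Fin n) ℂ)}
    (hfg : h ∈ Ideal.span {MvPolynomial.finSuccEquiv ℂ n f, MvPolynomial.finSuccEquiv ℂ n g})
    {z : ℂ} {v : Fin n → ℂ} (hz : z ≠ 0) (hv : ∀ i, v i ≠ 0)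
    (hzv : MvPolynomial.eval v (h.eval (algebraMap ℂ (MvPolynomial (Fin n) ℂ) z)) ≠ 0) :
    (Fin.cons z v : Fin (n + 1) → ℂ) ∈ torusCompl f g := by
  refine ⟨Fin.cases hz hv, ?_⟩
  by_contra! hcon
  rw [eval_cons, eval_cons] at hcon
  obtain ⟨a, b, rfl⟩ := Ideal.mem_span_pair.1 hfg
  exact hzv (by simp only [Polynomial.eval_add, Polynomial.eval_mul, map_add, map_mul, hcon.1,
    hcon.2, mul_zero, add_zero])

section Elimination

variable {f g : MvPolynomial (Fin (n + 1)) ℂ} {r k : MvPolynomial (Fin n) ℂ}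

section

variable (hr : Polynomial.C r ∈
  Ideal.span {MvPolynomial.finSuccEquiv ℂ n f, MvPolynomial.finSuccEquiv ℂ n g})

/-- The product of a punctured line and the locus `r ≠ 0`, for `r` in the elimination ideal of `f`
and `g`, as a part of the complement of the common zeros of `f` and `g`. -/
def torusComplCons : C({z : ℂ // z ≠ 0} × torusCompl r 0, torusCompl f g) where
  toFun x := ⟨Fin.cons x.1.1 x.2.1,
    cons_mem_torusCompl hr x.1.2 x.2.2.1 (by simpa using x.2.2.2)⟩
  continuous_toFun := .subtype_mk (.finCons (by fun_prop) (by fun_prop)) _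

theorem isOpenEmbedding_torusComplCons : IsOpenEmbedding (torusComplCons hr) :=
  .of_comp _ (isOpen_torusCompl f g).isOpenEmbedding_subtypeVal <|
    (Fin.consEquivL ℂ fun _ : Fin (n + 1) => ℂ).toHomeomorph.isOpenEmbedding.comp <|
      (isOpen_ne (x := (0 : ℂ))).isOpenEmbedding_subtypeVal.prodMap
        (isOpen_torusCompl r 0).isOpenEmbedding_subtypeVal

theorem isTame_range_torusComplCons (hr0 : r ≠ 0) : IsTame (range (torusComplCons hr)) := by
  have hr0' : MvPolynomial.rename Fin.succ r ≠ 0 :=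
    (map_ne_zero_iff _ (MvPolynomial.rename_injective _ (Fin.succ_injective n))).2 hr0
  refine (isTame_setOf_eval_ne_zero (isOpen_torusCompl f g) hr0').mono fun y hy => ?_
  rw [mem_ofPred_eq, MvPolynomial.eval_rename] at hy
  exact ⟨(⟨y.1 0, y.2.1 0⟩, ⟨Fin.tail y.1, fun j => y.2.1 j.succ, .inl hy⟩),
    Subtype.ext (Fin.cons_self_tail y.1)⟩

end

theorem isTame_range_inclusion_torusCompl (hr0 : r ≠ 0) :
    IsTame (range (inclusion (torusCompl_zero_subset r k))) :=
  (isTame_setOf_eval_ne_zero (isOpen_torusCompl r k) hr0).mono fun y hy =>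
    ⟨⟨y.1, y.2.1, .inl hy⟩, rfl⟩

theorem isOpenEmbedding_inclusion_torusCompl :
    IsOpenEmbedding (inclusion (torusCompl_zero_subset r k)) :=
  .of_comp _ (isOpen_torusCompl r k).isOpenEmbedding_subtypeVal
    (isOpen_torusCompl r 0).isOpenEmbedding_subtypeVal

theorem hasLatticeFundamentalGroup_torusCompl_of_slice
    (hr : Polynomial.C r ∈
      Ideal.span {MvPolynomial.finSuccEquiv ℂ n f, MvPolynomial.finSuccEquiv ℂ n g}) (hr0 : r ≠ 0)
    (hk : HasLatticeFundamentalGroup n (torusCompl r k)) {t : ℂ} (ht : t ≠ 0)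
    (hsec : ∀ v ∈ torusCompl r k, (Fin.cons t v : Fin (n + 1) → ℂ) ∈ torusCompl f g) :
    HasLatticeFundamentalGroup (n + 1) (torusCompl f g) := by
  let i := ContinuousMap.inclusion (torusCompl_zero_subset r k)
  let slice : C(torusCompl r k, torusCompl f g) :=
    ⟨fun v => ⟨Fin.cons t v.1, hsec v v.2⟩, .subtype_mk (.finCons (by fun_prop) (by fun_prop)) _⟩
  have := HasLatticeFundamentalGroup.punctured_complex.pathConnectedSpace
  have := isPathConnected_iff_pathConnectedSpace.1 (isPathConnected_torusCompl_zero hr0)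
  have he := isTame_range_torusComplCons hr hr0
  have := he.pathConnectedSpace (isPathConnected_range (torusComplCons hr).continuous)
  let w : torusCompl r 0 := Classical.arbitrary _
  have hgroup : HasLatticeFundamentalGroup (1 + n) (torusCompl f g) :=
    .of_slice .punctured_complex hk i (torusComplCons hr) slice ⟨t, ht⟩ w
      (map_surjective_of_isTame i isOpenEmbedding_inclusion_torusCompl
        (isTame_range_inclusion_torusCompl hr0) w)
      (map_surjective_of_isTame _ (isOpenEmbedding_torusComplCons hr) he _) fun _ => rfl
  rwa [add_comm 1 n] at hgroup

end Elimination

theorem hasLatticeFundamentalGroup_torusCompl {f g : MvPolynomial (Fin n) ℂ}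
    (h : IsRelPrime f g) : HasLatticeFundamentalGroup n (torusCompl f g) := by
  induction n with
  | zero =>
    have := (torusCompl_nonempty_of_isRelPrime h).to_subtype
    have : Unique (torusCompl f g) := uniqueOfSubsingleton this.some
    exact .of_simplyConnectedSpace
  | succ n ih =>
    have hE := isRelPrime_finSuccEquiv h
    obtain ⟨r, hr0, hr⟩ := exists_C_mem_span_of_isRelPrime hE
    obtain ⟨t, c, ht, hrel⟩ := exists_ne_zero_isRelPrime_eval_add_mul (k := ℂ) hr0 hE
    refine hasLatticeFundamentalGroup_torusCompl_of_slice hr hr0 (ih hrel) ht fun v hv => ?_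
    obtain ⟨hv0, hvr | hvk⟩ := hv
    · exact cons_mem_torusCompl hr ht hv0 (by simpa using hvr)
    · have hmem : MvPolynomial.finSuccEquiv ℂ n f +
          MvPolynomial.finSuccEquiv ℂ n g * Polynomial.C (algebraMap _ _ c) ∈
            Ideal.span {MvPolynomial.finSuccEquiv ℂ n f, MvPolynomial.finSuccEquiv ℂ n g} :=
        add_mem (Ideal.subset_span (by simp))
          (Ideal.mul_mem_right _ _ (Ideal.subset_span (by simp)))
      exact cons_mem_torusCompl hmem ht hv0 (by simpa using hvk)

end TorusCompl

/-! ### Complex points -/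

namespace ComplexPoints

variable {X Y : Scheme.{0}} [X.Over SpecC] [Y.Over SpecC]

theorem eq_closedPoint (s : SpecC) : s = IsLocalRing.closedPoint ℂ :=
  Subsingleton.elim (α := PrimeSpectrum ℂ) _ _

theorem top_le_preimage_iff (p : ComplexPoints X) (U : X.Opens) :
    ⊤ ≤ p.1 ⁻¹ᵁ U ↔ p.pt ∈ U := by
  refine ⟨fun h => h (x := IsLocalRing.closedPoint ℂ) trivial, fun h s _ => ?_⟩
  rw [eq_closedPoint s]
  exact h

/-- The map on complex points induced by a morphism over `ℂ`. -/
def map (f : X ⟶ Y) [f.IsOver SpecC] (p : ComplexPoints X) : ComplexPoints Y :=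
  ⟨p.1 ≫ f, by rw [Category.assoc, comp_over, p.2]⟩

variable (f : X ⟶ Y) [f.IsOver SpecC]

theorem pt_map (p : ComplexPoints X) : (map f p).pt = f p.pt := rfl

theorem eval_map (p : ComplexPoints X) (U : Y.Opens) (h : ⊤ ≤ (map f p).1 ⁻¹ᵁ U)
    (h' : ⊤ ≤ p.1 ⁻¹ᵁ (f ⁻¹ᵁ U)) (s : Γ(Y, U)) :
    (map f p).eval U h s = p.eval (f ⁻¹ᵁ U) h' (f.app U s) := by
  simp only [eval, map]
  congr 1

theorem continuous_map : Continuous (map f) := by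
  refine continuous_generateFrom_iff.2 ?_
  rintro _ ⟨U, s, W, hW, rfl⟩
  refine TopologicalSpace.isOpen_generateFrom_of_mem ⟨f ⁻¹ᵁ U, f.app U s, W, hW, ?_⟩
  ext p
  have hiff : ⊤ ≤ (map f p).1 ⁻¹ᵁ U ↔ ⊤ ≤ p.1 ⁻¹ᵁ (f ⁻¹ᵁ U) := by
    rw [top_le_preimage_iff, top_le_preimage_iff, pt_map]
    rfl
  constructor
  · rintro ⟨h, h1⟩
    exact ⟨hiff.1 h, by rwa [← eval_map f p U h]⟩
  · rintro ⟨h, h1⟩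
    exact ⟨hiff.2 h, by rwa [eval_map f p U (hiff.2 h) h]⟩

theorem isOpen_setOf_pt_mem (U : X.Opens) : IsOpen {p : ComplexPoints X | p.pt ∈ U} := by
  refine TopologicalSpace.isOpen_generateFrom_of_mem ⟨U, 0, univ, isOpen_univ, ?_⟩
  ext p
  exact ⟨fun h => ⟨(top_le_preimage_iff p U).2 h, trivial⟩,
    fun h => (top_le_preimage_iff p U).1 h.1⟩

theorem range_map [IsOpenImmersion f] : range (map f) = {p | p.pt ∈ f.opensRange} := by
  ext p
  constructor
  · rintro ⟨q, rfl⟩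
    simp [pt_map]
  · intro hp
    have hsub : range p.1 ⊆ range f := by
      rintro _ ⟨s, rfl⟩
      rw [eq_closedPoint s]
      exact hp
    refine ⟨⟨IsOpenImmersion.lift f p.1 hsub, ?_⟩,
      Subtype.ext (IsOpenImmersion.lift_fac f p.1 hsub)⟩
    rw [← comp_over f, ← Category.assoc, IsOpenImmersion.lift_fac]
    exact p.2

theorem eval_map_image [IsOpenImmersion f] (p : ComplexPoints X) {U : X.Opens}
    (h : ⊤ ≤ (map f p).1 ⁻¹ᵁ (f ''ᵁ U)) (h' : ⊤ ≤ p.1 ⁻¹ᵁ U) (s : Γ(X, U)) :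
    (map f p).eval (f ''ᵁ U) h ((f.appIso U).inv s) = p.eval U h' s := by
  simp only [eval, map]
  congr 1
  rw [← CommRingCat.comp_apply, ← Scheme.Hom.appLE_comp_appLE p.1 f (f ''ᵁ U) U ⊤
    (by rw [Scheme.Hom.preimage_image_eq]) h', ← Category.assoc, Scheme.Hom.appIso_inv_appLE]
  simp

theorem injective_map [Mono f] : Function.Injective (map f) := fun _ _ h =>
  Subtype.ext ((cancel_mono f).1 (congrArg Subtype.val h))

theorem isInducing_map [IsOpenImmersion f] : IsInducing (map f) := by
  refine ⟨le_antisymm (continuous_map f).le_induced (le_generateFrom ?_)⟩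
  rintro _ ⟨U, s, W, hW, rfl⟩
  refine isOpen_induced_iff.2 ⟨_, TopologicalSpace.isOpen_generateFrom_of_mem
    ⟨f ''ᵁ U, (f.appIso U).inv s, W, hW, rfl⟩, ?_⟩
  ext p
  have hiff : ⊤ ≤ (map f p).1 ⁻¹ᵁ (f ''ᵁ U) ↔ ⊤ ≤ p.1 ⁻¹ᵁ U := by
    rw [top_le_preimage_iff, top_le_preimage_iff, pt_map, Scheme.Hom.apply_mem_image_iff]
  constructor
  · rintro ⟨h, hs⟩
    exact ⟨hiff.1 h, by rwa [← eval_map_image f p h]⟩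
  · rintro ⟨h, hs⟩
    exact ⟨hiff.2 h, by rwa [eval_map_image f p (hiff.2 h) h]⟩

theorem isOpenEmbedding_map [IsOpenImmersion f] : IsOpenEmbedding (map f) where
  toIsInducing := isInducing_map f
  injective := injective_map f
  isOpen_range := range_map f ▸ isOpen_setOf_pt_mem _

/-- The value at a complex point as a ring homomorphism. -/
def evalHom (p : ComplexPoints X) (U : X.Opens) (h : ⊤ ≤ p.1 ⁻¹ᵁ U) : Γ(X, U) →+* ℂ :=
  ((p.1.appLE U ⊤ h) ≫ (Scheme.ΓSpecIso (.of ℂ)).hom).hom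

theorem evalHom_apply (p : ComplexPoints X) (U : X.Opens) (h : ⊤ ≤ p.1 ⁻¹ᵁ U) (s : Γ(X, U)) :
    p.evalHom U h s = p.eval U h s := rfl

theorem eval_presheaf_map (p : ComplexPoints X) {U V : X.Opens} (i : V ≤ U)
    (hU : ⊤ ≤ p.1 ⁻¹ᵁ U) (hV : ⊤ ≤ p.1 ⁻¹ᵁ V) (s : Γ(X, U)) :
    p.eval V hV (X.presheaf.map (homOfLE i).op s) = p.eval U hU s := by
  simp only [eval]
  congr 1
  rw [← CommRingCat.comp_apply, Scheme.Hom.map_appLE]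

theorem pt_mem_basicOpen_iff (p : ComplexPoints X) {U : X.Opens} (h : ⊤ ≤ p.1 ⁻¹ᵁ U)
    (s : Γ(X, U)) : p.pt ∈ X.basicOpen s ↔ p.eval U h s ≠ 0 := by
  rw [← isUnit_iff_ne_zero, ← evalHom_apply]
  constructor
  · intro hs
    have hs' := (top_le_preimage_iff p _).2 hs
    rw [evalHom_apply, ← eval_presheaf_map p (X.basicOpen_le s) h hs', ← evalHom_apply]
    exact (RingedSpace.isUnit_res_basicOpen X.toRingedSpace s).map _
  · intro hs
    have h1 : IsUnit (p.1.appLE U ⊤ h s) := by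
      have := hs.map (Scheme.ΓSpecIso (.of ℂ)).inv.hom
      simpa [evalHom] using this
    have h2 : (p.1 ⁻¹ᵁ X.basicOpen s) = ⊤ := by
      have h3 : SpecC.basicOpen (p.1.appLE U ⊤ h s) = ⊤ := Scheme.basicOpen_of_isUnit _ h1
      rw [Scheme.Hom.appLE, CommRingCat.comp_apply, Scheme.basicOpen_res,
        ← Scheme.preimage_basicOpen, top_inf_eq] at h3
      exact h3
    exact (top_le_preimage_iff p _).1 h2.ge

theorem continuous_eval_top (s : Γ(X, ⊤)) :
    Continuous fun p : ComplexPoints X => p.eval ⊤ le_top s :=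
  ⟨fun W hW => TopologicalSpace.isOpen_generateFrom_of_mem
    ⟨⊤, s, W, hW, Set.ext fun _ => ⟨fun h => ⟨le_top, h⟩, fun h => h.2⟩⟩⟩

theorem eval_eq_div {b : Γ(X, ⊤)} {U : X.Opens} (hbU : X.basicOpen b ≤ U) {s : Γ(X, U)}
    {a : Γ(X, ⊤)} {m : ℕ}
    (hab : X.presheaf.map (homOfLE le_top).op a = X.presheaf.map (homOfLE hbU).op s *
      X.presheaf.map (homOfLE (X.basicOpen_le b)).op (b ^ m))
    {q : ComplexPoints X} (hq : q.eval ⊤ le_top b ≠ 0) (hU : ⊤ ≤ q.1 ⁻¹ᵁ U) :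
    q.eval U hU s = q.eval ⊤ le_top a / q.eval ⊤ le_top b ^ m := by
  have hqb := (top_le_preimage_iff q _).2 ((pt_mem_basicOpen_iff q le_top b).2 hq)
  have heval := congrArg (q.evalHom (X.basicOpen b) hqb) hab
  rw [map_mul, evalHom_apply, evalHom_apply, evalHom_apply, eval_presheaf_map q _ le_top,
    eval_presheaf_map q _ hU, eval_presheaf_map q _ le_top, ← evalHom_apply q ⊤ le_top (b ^ m),
    map_pow] at heval
  exact (eq_div_iff (pow_ne_zero m hq)).2 heval.symm

theorem exists_eval_eq_div [IsAffine X] {p : ComplexPoints X} {U : X.Opens} (hp : p.pt ∈ U)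
    (s : Γ(X, U)) :
    ∃ (a b : Γ(X, ⊤)) (m : ℕ), p.eval ⊤ le_top b ≠ 0 ∧
      ∀ q : ComplexPoints X, q.eval ⊤ le_top b ≠ 0 →
        ∃ h, q.eval U h s = q.eval ⊤ le_top a / q.eval ⊤ le_top b ^ m := by
  obtain ⟨_, ⟨_, ⟨b, rfl⟩, rfl⟩, hpb, hbU⟩ :=
    (isBasis_basicOpen X).exists_subset_of_mem_open hp U.2
  have hbU : X.basicOpen b ≤ U := hbU
  have := (isAffineOpen_top X).isLocalization_basicOpen b
  obtain ⟨a, ⟨_, ⟨m, rfl⟩⟩, hab⟩ := IsLocalization.exists_mk'_eq (.powers b)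
    (X.presheaf.map (homOfLE hbU).op s)
  rw [eq_comm, IsLocalization.eq_mk'_iff_mul_eq] at hab
  refine ⟨a, b, m, (pt_mem_basicOpen_iff p le_top b).1 hpb, fun q hq => ?_⟩
  have hU := (top_le_preimage_iff q U).2 (hbU ((pt_mem_basicOpen_iff q le_top b).2 hq))
  exact ⟨hU, eval_eq_div hbU hab.symm hq hU⟩

theorem isInducing_eval_top [IsAffine X] :
    IsInducing fun (p : ComplexPoints X) (s : Γ(X, ⊤)) => p.eval ⊤ le_top s := by
  refine ⟨le_antisymm (continuous_pi continuous_eval_top).le_induced (le_generateFrom ?_)⟩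
  rintro _ ⟨U, s, W, hW, rfl⟩
  let ev : ComplexPoints X → Γ(X, ⊤) → ℂ := fun p s => p.eval ⊤ le_top s
  let := TopologicalSpace.induced ev Pi.topologicalSpace
  have hc (s : Γ(X, ⊤)) : Continuous fun p : ComplexPoints X => p.eval ⊤ le_top s :=
    (continuous_apply s).comp (continuous_induced_dom (f := ev))
  refine isOpen_iff_mem_nhds.2 fun p ⟨hU, hp⟩ => ?_
  obtain ⟨a, b, m, hb, hdiv⟩ := exists_eval_eq_div ((top_le_preimage_iff p U).1 hU) s
  have hcont : ContinuousAt (fun q : ComplexPoints X =>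
      q.eval ⊤ le_top a / q.eval ⊤ le_top b ^ m) p :=
    (hc a).continuousAt.div ((hc b).pow m).continuousAt (pow_ne_zero m hb)
  have hpW : p.eval ⊤ le_top a / p.eval ⊤ le_top b ^ m ∈ W := by
    obtain ⟨h, hs⟩ := hdiv p hb
    rwa [← hs]
  filter_upwards [(hc b).continuousAt.eventually_ne hb,
    hcont.eventually_mem (hW.mem_nhds hpW)] with q hq hqW
  obtain ⟨h, hs⟩ := hdiv q hq
  exact ⟨h, by rwa [hs]⟩

end ComplexPoints

section Affine

variable (A : Type) [CommRing A] [Algebra ℂ A]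

/-- The spectrum of a `ℂ`-algebra as a scheme over `ℂ`. -/
@[reducible] def specOver : (Spec (.of A)).Over SpecC :=
  ⟨Spec.map (CommRingCat.ofHom (algebraMap ℂ A))⟩

attribute [local instance] specOver

/-- The `ℂ`-valued points of a `ℂ`-algebra, with the topology of pointwise convergence. -/
def AlgPoints : Type := A →ₐ[ℂ] ℂ

instance : FunLike (AlgPoints A) A ℂ := inferInstanceAs (FunLike (A →ₐ[ℂ] ℂ) A ℂ)

instance : AlgHomClass (AlgPoints A) ℂ A ℂ := inferInstanceAs (AlgHomClass (A →ₐ[ℂ] ℂ) ℂ A ℂ)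

instance : TopologicalSpace (AlgPoints A) :=
  TopologicalSpace.induced (fun χ (a : A) => χ a) inferInstance

variable {A}

theorem AlgPoints.continuous_apply (a : A) : Continuous fun χ : AlgPoints A => χ a :=
  (_root_.continuous_apply a).comp continuous_induced_dom

/-- The complex point of `Spec A` defined by an algebra homomorphism. -/
def AlgPoints.toComplexPoint (χ : AlgPoints A) : ComplexPoints (Spec (.of A)) :=
  ⟨Spec.map (CommRingCat.ofHom (χ : A →ₐ[ℂ] ℂ).toRingHom), by
    change _ ≫ Spec.map _ = _
    rw [← Spec.map_comp, ← CommRingCat.ofHom_comp, ← Spec.map_id]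
    congr 1
    ext z
    exact (χ : A →ₐ[ℂ] ℂ).commutes z⟩

theorem AlgPoints.toComplexPoint_bijective :
    Function.Bijective (AlgPoints.toComplexPoint (A := A)) := by
  constructor
  · intro χ ψ h
    have h1 := Spec.map_injective (congrArg Subtype.val h)
    refine DFunLike.ext _ _ fun a => ?_
    exact congrArg (fun f => f.hom a) h1
  · rintro ⟨p, hp⟩
    obtain ⟨φ, rfl⟩ := Spec.map_surjective p
    have h1 : CommRingCat.ofHom (algebraMap ℂ A) ≫ φ = 𝟙 _ := by
      apply Spec.map_injective
      rw [Spec.map_comp, Spec.map_id]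
      exact hp
    exact ⟨⟨φ.hom, fun z => congrArg (fun f => f.hom z) h1⟩, rfl⟩

theorem AlgPoints.eval_toComplexPoint (χ : AlgPoints A) (s : Γ(Spec (.of A), ⊤)) :
    χ.toComplexPoint.eval ⊤ le_top s = χ ((Scheme.ΓSpecIso (.of A)).hom s) := by
  have h := Scheme.ΓSpecIso_naturality (CommRingCat.ofHom (χ : A →ₐ[ℂ] ℂ).toRingHom)
  have h1 := congrArg (fun f => f.hom s) h
  refine Eq.trans (congrArg (fun φ : Γ(Spec (.of A), ⊤) ⟶ Γ(SpecC, ⊤) =>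
    (Scheme.ΓSpecIso (.of ℂ)).hom (φ.hom s)) ?_) h1
  exact (Scheme.Hom.app_eq_appLE _).symm

theorem AlgPoints.isHomeomorph_toComplexPoint :
    IsHomeomorph (AlgPoints.toComplexPoint (A := A)) := by
  have hind : IsInducing (AlgPoints.toComplexPoint (A := A)) := by
    rw [ComplexPoints.isInducing_eval_top.of_comp_iff.symm]
    let e : Γ(Spec (.of A), ⊤) ≃ A :=
      ((Scheme.ΓSpecIso (.of A)).commRingCatIsoToRingEquiv).toEquiv
    have h1 : IsInducing fun (χ : AlgPoints A) (a : A) => χ a := ⟨rfl⟩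
    have h2 := (Homeomorph.piCongrLeft (Y := fun _ : A => ℂ) e).symm.isInducing.comp h1
    convert h2 using 1
    ext χ s
    exact AlgPoints.eval_toComplexPoint χ s
  exact (isHomeomorph_iff_isEmbedding_surjective).2
    ⟨⟨hind, toComplexPoint_bijective.1⟩, toComplexPoint_bijective.2⟩

end Affine

/-! ### Étale coordinates -/

section ImplicitFunction

theorem exists_openPartialHomeomorph_of_isEmbedding {Y M E F : Type*} [TopologicalSpace Y]
    [Nonempty Y] [TopologicalSpace M] [TopologicalSpace E] [TopologicalSpace F] {c : Y → M}
    (hc : IsEmbedding c) (Ψ : OpenPartialHomeomorph M (E × F)) {e₀ : E}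
    (hrange : ∀ x ∈ Ψ.source, (Ψ x).1 = e₀ ↔ x ∈ range c) :
    ∃ e : OpenPartialHomeomorph Y F, e.source = c ⁻¹' Ψ.source ∧ ∀ y, e y = (Ψ (c y)).2 := by
  have hmk : Continuous fun w : F => (e₀, w) := by fun_prop
  have hΨc {y : Y} (hy : c y ∈ Ψ.source) : (e₀, (Ψ (c y)).2) = Ψ (c y) :=
    Prod.ext ((hrange _ hy).2 ⟨y, rfl⟩).symm rfl
  have hsymm {w : F} (hw : (e₀, w) ∈ Ψ.target) :
      c (Function.invFun c (Ψ.symm (e₀, w))) = Ψ.symm (e₀, w) :=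
    Function.invFun_eq ((hrange _ (Ψ.map_target hw)).1 (by rw [Ψ.right_inv hw]))
  refine ⟨{
    toFun := fun y => (Ψ (c y)).2
    invFun := fun w => Function.invFun c (Ψ.symm (e₀, w))
    source := c ⁻¹' Ψ.source
    target := (fun w => (e₀, w)) ⁻¹' Ψ.target
    map_source' := fun y hy => by
      rw [mem_preimage, hΨc hy]
      exact Ψ.map_source hy
    map_target' := fun w hw => by
      rw [mem_preimage, hsymm hw]
      exact Ψ.map_target hw
    left_inv' := fun y hy => by
      rw [hΨc hy, Ψ.left_inv hy, Function.leftInverse_invFun hc.injective]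
    right_inv' := fun w hw => by rw [hsymm hw, Ψ.right_inv hw]
    open_source := Ψ.open_source.preimage hc.continuous
    open_target := Ψ.open_target.preimage hmk
    continuousOn_toFun := continuous_snd.comp_continuousOn
      (Ψ.continuousOn.comp hc.continuous.continuousOn (mapsTo_preimage _ _))
    continuousOn_invFun := hc.isInducing.continuousOn_iff.2 <|
      (Ψ.continuousOn_symm.comp hmk.continuousOn (mapsTo_preimage _ _)).congr
        fun _ hw => hsymm hw }, rfl, fun _ => rfl⟩

variable {𝕜 : Type*} [NontriviallyNormedField 𝕜] {ι σ : Type*} [Fintype ι]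

theorem hasStrictFDerivAt_eval (p : MvPolynomial ι 𝕜) (x : ι → 𝕜) :
    HasStrictFDerivAt (fun y : ι → 𝕜 => MvPolynomial.eval y p)
      (∑ i, MvPolynomial.eval x (MvPolynomial.pderiv i p) •
        (ContinuousLinearMap.proj i : (ι → 𝕜) →L[𝕜] 𝕜)) x := by
  classical
  induction p using MvPolynomial.induction_on with
  | C a =>
    simp only [MvPolynomial.eval_C]
    exact (hasStrictFDerivAt_const (𝕜 := 𝕜) a x).congr_fderiv (by ext v; simp)
  | add p q hp hq =>
    simp only [map_add]
    refine (hp.fun_add hq).congr_fderiv ?_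
    ext v
    simp [add_mul, Finset.sum_add_distrib]
  | mul_X p j hp =>
    have hX : HasStrictFDerivAt (fun y : ι → 𝕜 => y j)
        (ContinuousLinearMap.proj j : (ι → 𝕜) →L[𝕜] 𝕜) x :=
      (ContinuousLinearMap.proj j : (ι → 𝕜) →L[𝕜] 𝕜).hasStrictFDerivAt
    simp only [map_mul, MvPolynomial.eval_X]
    refine (hp.fun_mul hX).congr_fderiv ?_
    ext v
    simp only [Derivation.leibniz, MvPolynomial.pderiv_X, smul_eq_mul, map_add, map_mul,
      MvPolynomial.eval_X, Pi.single_apply, apply_ite (MvPolynomial.eval x), map_one, map_zero]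
    simp [add_mul, Finset.sum_add_distrib, Finset.mul_sum, mul_assoc]

variable (q : σ → MvPolynomial ι 𝕜) (m : σ → ι)

/-- The derivative at `x` of `y ↦ (q(y), (yₖ)_{k ∉ range m})`. -/
def fderivEvalProd (x : ι → 𝕜) : (ι → 𝕜) →L[𝕜] (σ → 𝕜) × ({i // i ∉ range m} → 𝕜) :=
  (ContinuousLinearMap.pi fun s => ∑ i, MvPolynomial.eval x (MvPolynomial.pderiv i (q s)) •
    ContinuousLinearMap.proj i).prod (ContinuousLinearMap.pi fun k => .proj k.1)

theorem hasStrictFDerivAt_evalProd [Finite σ] (x : ι → 𝕜) :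
    HasStrictFDerivAt (fun y : ι → 𝕜 => (fun s => MvPolynomial.eval y (q s),
      fun k : {i // i ∉ range m} => y k.1)) (fderivEvalProd q m x) x := by
  classical
  have := Fintype.ofFinite σ
  let free : (ι → 𝕜) →L[𝕜] ({i // i ∉ range m} → 𝕜) := .pi fun k => .proj k.1
  exact (hasStrictFDerivAt_pi.2 fun s => hasStrictFDerivAt_eval (q s) x).prodMk
    free.hasStrictFDerivAt

variable {q m}

theorem injective_fderivEvalProd [Fintype σ] [DecidableEq σ] (hm : Function.Injective m) {x : ι → 𝕜}
    (hdet : (Matrix.of fun s t => MvPolynomial.eval x (MvPolynomial.pderiv (m s) (q t))).det ≠ 0) :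
    Function.Injective (fderivEvalProd q m x) := by
  rw [injective_iff_map_eq_zero]
  intro v hv
  have hfree (i) (hi : i ∉ range m) : v i = 0 := congrFun (congrArg Prod.snd hv) ⟨i, hi⟩
  have hq (s) : ∑ i, MvPolynomial.eval x (MvPolynomial.pderiv i (q s)) * v i = 0 := by
    simpa [fderivEvalProd] using congrFun (congrArg Prod.fst hv) s
  have hbound : (fun s => v (m s)) = 0 := by
    refine Matrix.eq_zero_of_vecMul_eq_zero hdet (funext fun s => ?_)
    rw [Matrix.vecMul, dotProduct, Pi.zero_apply, ← hq s]
    refine Finset.sum_of_injOn m hm.injOn (by simp) (fun i _ hi => ?_) fun t _ => ?_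
    · rw [hfree i (by simpa using hi), mul_zero]
    · rw [Matrix.of_apply, mul_comm]
  ext i
  by_cases hi : i ∈ range m
  · obtain ⟨s, rfl⟩ := hi
    exact congrFun hbound s
  · exact hfree i hi

theorem finrank_pi_eq_finrank_prod (K : Type*) [Field K] {ι σ : Type*} [Finite ι] {m : σ → ι}
    (hm : Function.Injective m) :
    Module.finrank K (ι → K) = Module.finrank K ((σ → K) × ({i // i ∉ range m} → K)) := by
  classical
  have := Finite.of_injective m hm
  have := Fintype.ofFinite ι
  have := Fintype.ofFinite σ
  rw [Module.finrank_prod, Module.finrank_fintype_fun_eq_card, Module.finrank_fintype_fun_eq_card,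
    Module.finrank_fintype_fun_eq_card, ← Set.card_range_of_injective hm]
  exact (Fintype.card_congr (Equiv.Set.sumCompl (range m)).symm).trans Fintype.card_sum

theorem exists_openPartialHomeomorph_evalProd [CompleteSpace 𝕜] {ι : Type*} [Finite ι]
    [Fintype σ] [DecidableEq σ] {q : σ → MvPolynomial ι 𝕜} {m : σ → ι}
    (hm : Function.Injective m) {x : ι → 𝕜}
    (hdet : (Matrix.of fun s t => MvPolynomial.eval x (MvPolynomial.pderiv (m s) (q t))).det ≠ 0) :
    ∃ Ψ : OpenPartialHomeomorph (ι → 𝕜) ((σ → 𝕜) × ({i // i ∉ range m} → 𝕜)), x ∈ Ψ.source ∧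
      ∀ y, Ψ y = (fun s => MvPolynomial.eval y (q s), fun k => y k.1) := by
  classical
  have := Fintype.ofFinite ι
  let E : (ι → 𝕜) ≃L[𝕜] (σ → 𝕜) × ({i // i ∉ range m} → 𝕜) :=
    (LinearEquiv.ofInjectiveOfFinrankEq (fderivEvalProd q m x).toLinearMap
      (injective_fderivEvalProd hm hdet) (finrank_pi_eq_finrank_prod 𝕜 hm)).toContinuousLinearEquiv
  have hE : (E : (ι → 𝕜) →L[𝕜] _) = fderivEvalProd q m x := by
    ext v <;> rfl
  have hΨ : HasStrictFDerivAt (fun y : ι → 𝕜 => (fun s => MvPolynomial.eval y (q s),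
      fun k : {i // i ∉ range m} => y k.1)) (E : (ι → 𝕜) →L[𝕜] _) x :=
    hE ▸ hasStrictFDerivAt_evalProd q m x
  exact ⟨hΨ.toOpenPartialHomeomorph _, hΨ.mem_toOpenPartialHomeomorph_source, fun _ => rfl⟩

end ImplicitFunction

namespace AlgPoints

variable {A : Type} [CommRing A] [Algebra ℂ A] {ι σ : Type}

/-- The coordinates of a point of an algebra with respect to a family of generators. -/
def coords (P : Algebra.Generators ℂ A ι) (χ : AlgPoints A) : ι → ℂ := fun i => χ (P.val i)

theorem apply_aeval {κ : Type*} (χ : AlgPoints A) (a : κ → A) (p : MvPolynomial κ ℂ) :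
    χ (MvPolynomial.aeval a p) = MvPolynomial.eval (fun k => χ (a k)) p := by
  rw [← MvPolynomial.coe_aeval_eq_eval, RingHom.coe_coe]
  exact MvPolynomial.comp_aeval_apply (φ := (χ : A →ₐ[ℂ] ℂ)) a p

theorem apply_eq_eval (P : Algebra.Generators ℂ A ι) (χ : AlgPoints A) (a : A) :
    χ a = MvPolynomial.eval (χ.coords P) (P.σ a) :=
  (congrArg χ (P.aeval_val_σ a)).symm.trans (apply_aeval χ P.val _)

theorem coords_injective (P : Algebra.Generators ℂ A ι) : Function.Injective (coords P) :=
  fun χ ψ h => DFunLike.ext _ _ fun a => by rw [χ.apply_eq_eval P, ψ.apply_eq_eval P, h]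

theorem isInducing_coords (P : Algebra.Generators ℂ A ι) : IsInducing (coords P) := by
  refine ⟨le_antisymm (continuous_pi fun i => continuous_apply _).le_induced ?_⟩
  let := TopologicalSpace.induced (coords P) Pi.topologicalSpace
  change _ ≤ TopologicalSpace.induced _ _
  rw [← continuous_iff_le_induced]
  refine continuous_pi fun a => ?_
  simp only [apply_eq_eval P]
  exact (MvPolynomial.continuous_eval _).comp continuous_induced_dom

theorem mem_range_coords (P : Algebra.Presentation ℂ A ι σ) {x : ι → ℂ}
    (hx : ∀ s, MvPolynomial.eval x (P.relation s) = 0) : x ∈ range (coords P.toGenerators) := by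
  have hker : P.ker ≤ RingHom.ker (MvPolynomial.aeval (R := ℂ) x) := by
    rw [← P.span_range_relation_eq_ker, Ideal.span_le]
    rintro _ ⟨s, rfl⟩
    simpa using hx s
  let φ : P.Ring ⧸ P.ker →ₐ[ℂ] ℂ := Ideal.Quotient.liftₐ P.ker (MvPolynomial.aeval x) hker
  let e : (P.Ring ⧸ P.ker) ≃ₐ[ℂ] A := P.quotientEquiv.restrictScalars ℂ
  refine ⟨φ.comp e.symm.toAlgHom, funext fun i => ?_⟩
  have he : e.symm (P.val i) = Ideal.Quotient.mk P.ker (MvPolynomial.X i) := by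
    rw [AlgEquiv.symm_apply_eq]
    change _ = algebraMap P.Ring A (MvPolynomial.X i)
    simp [P.algebraMap_apply]
  change φ (e.symm (P.val i)) = x i
  rw [he]
  exact MvPolynomial.aeval_X x i

theorem eval_coords_relation (P : Algebra.Presentation ℂ A ι σ) (χ : AlgPoints A) (s : σ) :
    MvPolynomial.eval (χ.coords P.toGenerators) (P.relation s) = 0 :=
  (apply_aeval χ P.val _).symm.trans ((congrArg χ (P.aeval_val_relation s)).trans (map_zero χ))

theorem det_pderiv_relation_ne_zero [Fintype σ] [DecidableEq σ]
    (P : Algebra.SubmersivePresentation ℂ A ι σ) (χ : AlgPoints A) :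
    (Matrix.of fun s t => MvPolynomial.eval (χ.coords P.toGenerators)
      (MvPolynomial.pderiv (P.map s) (P.relation t))).det ≠ 0 := by
  have hunit := P.jacobian_isUnit.map χ
  rw [P.jacobian_eq_jacobiMatrix_det, P.algebraMap_apply, apply_aeval, RingHom.map_det,
    RingHom.mapMatrix_apply] at hunit
  convert hunit.ne_zero using 2
  ext s t
  rw [Matrix.of_apply, Matrix.map_apply, P.jacobiMatrix_apply]
  rfl

end AlgPoints


section FreeVariables

/-- The free variables of a submersive presentation: those not matched with a relation. -/
abbrev FreeVars {R A ι σ : Type*} [CommRing R] [CommRing A] [Algebra R A]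
    (P : Algebra.PreSubmersivePresentation R A ι σ) : Type _ := {i : ι // i ∉ range P.map}

theorem AlgPoints.exists_chart {A : Type} [CommRing A] [Algebra ℂ A] {ι σ : Type} [Finite ι]
    [Finite σ] (P : Algebra.SubmersivePresentation ℂ A ι σ) (χ₀ : AlgPoints A) :
    ∃ e : OpenPartialHomeomorph (AlgPoints A) (FreeVars P.toPreSubmersivePresentation → ℂ),
      χ₀ ∈ e.source ∧ ∀ χ, e χ = fun k => χ (P.val k.1) := by
  classical
  have := Fintype.ofFinite ι
  have := Fintype.ofFinite σ
  have : Nonempty (AlgPoints A) := ⟨χ₀⟩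
  obtain ⟨Ψ, hx₀, hΨ⟩ :=
    exists_openPartialHomeomorph_evalProd P.map_inj (det_pderiv_relation_ne_zero P χ₀)
  have hrange : ∀ x ∈ Ψ.source, (Ψ x).1 = 0 ↔ x ∈ range (coords P.toGenerators) := by
    intro x _
    rw [hΨ]
    constructor
    · exact fun hx => mem_range_coords P.toPresentation (congrFun hx)
    · rintro ⟨χ, rfl⟩
      exact funext (eval_coords_relation P.toPresentation χ)
  obtain ⟨e, hsource, he⟩ := exists_openPartialHomeomorph_of_isEmbedding
    ⟨isInducing_coords P.toGenerators, coords_injective P.toGenerators⟩ Ψ hrange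
  exact ⟨e, hsource ▸ hx₀, fun χ => by rw [he, hΨ]; rfl⟩

theorem isAlgebraic_of_formallyUnramified {R A : Type*} [CommRing R] [IsDomain R] [CommRing A]
    [IsDomain A] [Algebra R A] [FaithfulSMul R A] [Algebra.FiniteType R A]
    [Algebra.FormallyUnramified R A] : Algebra.IsAlgebraic R A := by
  let K := FractionRing R
  let L := FractionRing A
  have : FaithfulSMul R L := .trans R A L
  let : Algebra K L := FractionRing.liftAlgebra R L
  have : IsScalarTower R K L := FractionRing.isScalarTower_liftAlgebra R L
  have : Algebra.FormallyUnramified A L := .of_isLocalization (nonZeroDivisors A)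
  have : Algebra.FormallyUnramified R L := .comp R A L
  have : Algebra.FormallyUnramified K L := .of_restrictScalars R K L
  have : Algebra.EssFiniteType A L := .of_isLocalization L (nonZeroDivisors A)
  have : Algebra.EssFiniteType R L := .comp R A L
  have : Algebra.EssFiniteType K L := .of_comp R K L
  have : Algebra.IsSeparable K L := Algebra.FormallyUnramified.isSeparable K L
  refine ⟨fun a => (isAlgebraic_algebraMap_iff (IsFractionRing.injective A L)).1 ?_⟩
  exact (IsFractionRing.isAlgebraic_iff R K L).2 (Algebra.IsAlgebraic.isAlgebraic _)

theorem formallyUnramified_of_span_eq_top {k R A : Type*} [CommRing k] [CommRing R] [CommRing A]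
    [Algebra k R] [Algebra k A] [Algebra R A] [IsScalarTower k R A]
    (h : Submodule.span A (range fun r => KaehlerDifferential.D k A (algebraMap R A r)) = ⊤) :
    Algebra.FormallyUnramified R A := by
  have hzero : KaehlerDifferential.map k R A A = 0 := by
    refine LinearMap.ext_on_range h fun r => ?_
    rw [KaehlerDifferential.map_D, LinearMap.zero_apply, Algebra.algebraMap_self,
      RingHom.id_apply, Derivation.map_algebraMap]
  have hsurj := KaehlerDifferential.map_surjective k R A
  rw [hzero] at hsurj
  exact ⟨⟨fun x y => (hsurj x).elim fun _ hx => (hsurj y).elim fun _ hy => hx.symm.trans hy⟩⟩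

variable {k A ι σ : Type*} [CommRing k] [CommRing A] [Algebra k A]

/-- The polynomial subring in the free variables, over which the algebra is étale. -/
def freeVarsAlgHom (P : Algebra.PreSubmersivePresentation k A ι σ) :
    MvPolynomial (FreeVars P) k →ₐ[k] A :=
  MvPolynomial.aeval fun i => P.val i.1

theorem formallyUnramified_freeVarsAlgHom [Finite σ]
    (P : Algebra.SubmersivePresentation k A ι σ) :
    (freeVarsAlgHom P.toPreSubmersivePresentation).toRingHom.FormallyUnramified := by
  let φ := freeVarsAlgHom P.toPreSubmersivePresentation
  let := φ.toRingHom.toAlgebra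
  have : IsScalarTower k (MvPolynomial (FreeVars P.toPreSubmersivePresentation) k) A :=
    .of_algebraMap_eq fun z => (φ.commutes z).symm
  refine formallyUnramified_of_span_eq_top (k := k) (top_unique ?_)
  rw [← P.basisKaehler.span_eq]
  refine Submodule.span_mono ?_
  rintro _ ⟨i, rfl⟩
  rw [Algebra.SubmersivePresentation.basisKaehler_apply]
  exact ⟨MvPolynomial.X ⟨i.1, i.2⟩, congrArg _ (MvPolynomial.aeval_X _ _)⟩

theorem exists_dvd_freeVarsAlgHom [IsDomain k] [IsDomain A] [Finite ι] [Finite σ]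
    (P : Algebra.SubmersivePresentation k A ι σ) {g : A} (hg : g ≠ 0) :
    ∃ p ≠ 0, g ∣ freeVarsAlgHom P.toPreSubmersivePresentation p := by
  let φ := freeVarsAlgHom P.toPreSubmersivePresentation
  by_cases hφ : Function.Injective φ
  · let := φ.toRingHom.toAlgebra
    have : IsScalarTower k (MvPolynomial (FreeVars P.toPreSubmersivePresentation) k) A :=
      .of_algebraMap_eq fun z => (φ.commutes z).symm
    have : FaithfulSMul (MvPolynomial (FreeVars P.toPreSubmersivePresentation) k) A :=
      (faithfulSMul_iff_algebraMap_injective _ A).2 hφ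
    have : Algebra.FiniteType k A := P.toGenerators.finiteType
    have : Algebra.FiniteType (MvPolynomial (FreeVars P.toPreSubmersivePresentation) k) A :=
      .of_restrictScalars_finiteType k _ A
    have : Algebra.FormallyUnramified
      (MvPolynomial (FreeVars P.toPreSubmersivePresentation) k) A :=
        formallyUnramified_freeVarsAlgHom P
    have halg := isAlgebraic_of_formallyUnramified
      (R := MvPolynomial (FreeVars P.toPreSubmersivePresentation) k) (A := A)
    exact (halg.isAlgebraic g).exists_nonzero_dvd (mem_nonZeroDivisors_of_ne_zero hg)
  · obtain ⟨p, hp, hp0⟩ : ∃ p, φ p = 0 ∧ p ≠ 0 := by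
      simpa only [injective_iff_map_eq_zero, not_forall, exists_prop] using hφ
    exact ⟨p, hp0, hp ▸ dvd_zero g⟩

end FreeVariables

section SmoothCharts

theorem exists_openPartialHomeomorph_of_isOpenEmbedding {Y M Z F : Type*} [TopologicalSpace Y]
    [TopologicalSpace M] [TopologicalSpace Z] [TopologicalSpace F] {i : Y → M} {h : Z → M}
    (hi : IsOpenEmbedding i) (hh : IsOpenEmbedding h) (e : OpenPartialHomeomorph Z F) {y₀ : Y}
    {z₀ : Z} (hz₀ : z₀ ∈ e.source) (hy₀ : h z₀ = i y₀) :
    ∃ e' : OpenPartialHomeomorph Y F, y₀ ∈ e'.source ∧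
      ∀ y ∈ e'.source, ∃ z, h z = i y ∧ e' y = e z := by
  have : Nonempty Y := ⟨y₀⟩
  have : Nonempty Z := ⟨z₀⟩
  have hleft (z : Z) : (hh.toOpenPartialHomeomorph h).symm (h z) = z :=
    (hh.toOpenPartialHomeomorph h).left_inv trivial
  refine ⟨(hi.toOpenPartialHomeomorph i).trans ((hh.toOpenPartialHomeomorph h).symm.trans e),
    ⟨trivial, ⟨z₀, trivial, hy₀⟩, ?_⟩, ?_⟩
  · change (hh.toOpenPartialHomeomorph h).symm (i y₀) ∈ e.source
    rwa [← hy₀, hleft]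
  · rintro y ⟨-, ⟨z, -, hz : h z = i y⟩, -⟩
    refine ⟨z, hz, ?_⟩
    change e ((hh.toOpenPartialHomeomorph h).symm (i y)) = e z
    rw [← hz, hleft]

attribute [local instance] specOver

theorem AlgPoints.pt_toComplexPoint_mem_basicOpen {A : Type} [CommRing A] [Algebra ℂ A]
    (χ : AlgPoints A) (a : A) : χ.toComplexPoint.pt ∈ PrimeSpectrum.basicOpen a ↔ χ a ≠ 0 := by
  change χ a ∉ IsLocalRing.maximalIdeal ℂ ↔ _
  rw [IsLocalRing.mem_maximalIdeal, mem_nonunits_iff, not_not, isUnit_iff_ne_zero]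

theorem opens_specC_eq_top {U : SpecC.Opens} {s : SpecC} (h : s ∈ U) : U = ⊤ :=
  top_le_iff.1 fun t _ => (Subsingleton.elim (α := PrimeSpectrum ℂ) s t) ▸ h

theorem exists_submersivePresentation {X : Scheme.{0}} (f : X ⟶ SpecC)
    [LocallyOfFinitePresentation f] {x : X} (hx : x ∈ f.smoothLocus) :
    ∃ (A : Type) (_ : CommRing A) (_ : Algebra ℂ A) (ι τ : Type) (_ : Finite ι) (_ : Finite τ)
      (_ : Algebra.SubmersivePresentation ℂ A ι τ) (g : Spec (.of A) ⟶ X),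
      IsOpenImmersion g ∧ g ≫ f = Spec.map (CommRingCat.ofHom (algebraMap ℂ A)) ∧
      x ∈ range g := by
  let W := f.smoothLocus
  have hsmooth : Smooth (W.ι ≫ f) := by
    rw [← Scheme.Hom.smoothLocus_eq_top_iff, ← Scheme.Hom.preimage_smoothLocus_eq]
    exact top_le_iff.1 fun w _ => w.2
  obtain ⟨U, hU, V, hV, hxV, hVU, hstd⟩ :=
    Smooth.exists_isStandardSmooth (W.ι ≫ f) (⟨x, hx⟩ : W)
  obtain rfl : U = ⊤ := opens_specC_eq_top (hVU hxV)
  let φ : CommRingCat.of ℂ ⟶ Γ(W, V) :=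
    (Scheme.ΓSpecIso (.of ℂ)).inv ≫ (W.ι ≫ f).appLE ⊤ V hVU
  let : Algebra ℂ Γ(W, V) := φ.hom.toAlgebra
  have hA : Algebra.IsStandardSmooth ℂ Γ(W, V) := RingHom.isStandardSmooth_respectsIso.2 _
    (Scheme.ΓSpecIso (.of ℂ)).symm.commRingCatIsoToRingEquiv hstd
  obtain ⟨ι, τ, hτ, hι, ⟨P⟩⟩ := hA.out
  refine ⟨Γ(W, V), inferInstance, inferInstance, ι, τ, hι, hτ, P, hV.fromSpec ≫ W.ι,
    inferInstance, ?_, ?_⟩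
  · rw [Category.assoc, ← hU.SpecMap_appLE_fromSpec (W.ι ≫ f) hV hVU, IsAffineOpen.fromSpec_top,
      Scheme.isoSpec_Spec_inv, ← Spec.map_comp]
    rfl
  · obtain ⟨z, hz⟩ : (⟨x, hx⟩ : W) ∈ hV.fromSpec.opensRange := by
      rwa [IsAffineOpen.opensRange_fromSpec]
    exact ⟨z, by rw [Scheme.Hom.comp_apply, hz]; rfl⟩

section AffineChart

variable {X : Scheme.{0}} [X.Over SpecC] {A : Type} [CommRing A] [Algebra ℂ A]
  (g : Spec (.of A) ⟶ X) [g.IsOver SpecC]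

/-- The complex points of `X` that come from an affine chart `Spec A ⟶ X`. -/
def affineChart (χ : AlgPoints A) : ComplexPoints X := .map g χ.toComplexPoint

theorem isOpenEmbedding_affineChart [IsOpenImmersion g] : IsOpenEmbedding (affineChart g) :=
  (ComplexPoints.isOpenEmbedding_map g).comp
    AlgPoints.isHomeomorph_toComplexPoint.isOpenEmbedding

theorem range_affineChart [IsOpenImmersion g] :
    range (affineChart g) = {p | p.pt ∈ g.opensRange} := by
  rw [← ComplexPoints.range_map]
  exact AlgPoints.toComplexPoint_bijective.2.range_comp (ComplexPoints.map g)

theorem exists_ne_zero_affineChart_mem [IsIntegral X] [IsOpenImmersion g]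
    [Nonempty (Spec (.of A))] (U : X.Opens) [Nonempty U] :
    ∃ b : A, b ≠ 0 ∧ ∀ χ : AlgPoints A, χ b ≠ 0 → (affineChart g χ).pt ∈ U := by
  obtain ⟨z, hzU, ⟨w, hw⟩⟩ : ((U : Set X) ∩ g.opensRange).Nonempty :=
    nonempty_preirreducible_inter U.2 g.opensRange.2
      (Set.nonempty_coe_sort.1 (inferInstanceAs (Nonempty U))) (range_nonempty g)
  obtain ⟨_, ⟨b, rfl⟩, hwb, hbU⟩ := PrimeSpectrum.isTopologicalBasis_basic_opens
    |>.exists_subset_of_mem_open (show w ∈ g ⁻¹ᵁ U by rwa [Scheme.Hom.mem_preimage, hw])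
      (g ⁻¹ᵁ U).2
  refine ⟨b, ?_, fun χ hχ => hbU ((χ.pt_toComplexPoint_mem_basicOpen b).2 hχ)⟩
  rintro rfl
  exact hwb (Ideal.zero_mem _)

theorem exists_polynomial_affineChart_mem [IsIntegral X] [IsOpenImmersion g]
    [Nonempty (Spec (.of A))] {ι τ : Type} [Finite ι] [Finite τ]
    (P : Algebra.SubmersivePresentation ℂ A ι τ) (U : X.Opens) [Nonempty U] :
    ∃ p : MvPolynomial (FreeVars P.toPreSubmersivePresentation) ℂ, p ≠ 0 ∧
      ∀ χ : AlgPoints A, MvPolynomial.eval (fun k => χ (P.val k.1)) p ≠ 0 →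
        (affineChart g χ).pt ∈ U := by
  have : IsIntegral (Spec (.of A)) := isIntegral_of_isOpenImmersion g
  have : IsDomain A :=
    (Scheme.ΓSpecIso (.of A)).commRingCatIsoToRingEquiv.symm.toMulEquiv.isDomain _
  obtain ⟨b, hb, hbU⟩ := exists_ne_zero_affineChart_mem g U
  obtain ⟨p, hp, a, ha⟩ := exists_dvd_freeVarsAlgHom P hb
  refine ⟨p, hp, fun χ hχ => hbU χ fun hχb => hχ ?_⟩
  rw [← AlgPoints.apply_aeval]
  exact (congrArg χ ha).trans (by rw [map_mul, hχb, zero_mul])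

end AffineChart

theorem isTame_setOf_pt_mem (X : Scheme.{0}) [X.Over SpecC] [IsIntegral X]
    [LocallyOfFiniteType (X ↘ SpecC)] {Q : ComplexPoints X → Prop} (hQ : IsOpen {p | Q p})
    (hsmooth : ∀ p, Q p → p.pt ∈ (X ↘ SpecC).smoothLocus) (U : X.Opens) [Nonempty U] :
    IsTame {y : {p // Q p} | y.1.pt ∈ U} := by
  refine isTame_of_charts fun y => ?_
  obtain ⟨A, _, _, ι, τ, _, _, P, g, _, hg, x, hx⟩ :=
    exists_submersivePresentation (X ↘ SpecC) (hsmooth y.1 y.2)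
  have : g.IsOver SpecC := ⟨hg⟩
  have : Nonempty (Spec (.of A)) := ⟨x⟩
  obtain ⟨χ₀, hχ₀⟩ : y.1 ∈ range (affineChart g) := by
    rw [range_affineChart]
    exact ⟨x, hx⟩
  obtain ⟨e, heχ₀, he⟩ := AlgPoints.exists_chart P χ₀
  obtain ⟨p, hp, hpU⟩ := exists_polynomial_affineChart_mem g P U
  obtain ⟨e', hy, he'⟩ := exists_openPartialHomeomorph_of_isOpenEmbedding
    hQ.isOpenEmbedding_subtypeVal (isOpenEmbedding_affineChart g) e heχ₀ hχ₀
  refine ⟨_, inferInstance, e', p, hy, hp, fun q hq hqp => ?_⟩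
  obtain ⟨χ, hχq, hχe⟩ := he' q hq
  rw [hχe, he] at hqp
  rw [mem_ofPred_eq, ← hχq]
  exact hpU χ hqp

end SmoothCharts

/-! ### The torus -/

section Laurent

/-- The ring of Laurent polynomials in `n` variables. -/
abbrev Laurent (R : Type*) [CommRing R] (n : ℕ) : Type _ := AddMonoidAlgebra R (Fin n → ℤ)

variable {R : Type*} [CommRing R] {n : ℕ}

/-- The inclusion of the exponents of monomials into those of Laurent monomials. -/
def laurentExponent (n : ℕ) : (Fin n →₀ ℕ) →+ (Fin n → ℤ) :=
  (Nat.castAddMonoidHom ℤ).compLeft (Fin n) |>.comp Finsupp.coeFnAddHom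

theorem laurentExponent_injective : Function.Injective (laurentExponent n) := fun _ _ h =>
  Finsupp.ext fun i => Nat.cast_injective (congrFun h i)

/-- The inclusion of the polynomials into the Laurent polynomials. -/
def toLaurent : MvPolynomial (Fin n) R →ₐ[R] Laurent R n :=
  AddMonoidAlgebra.mapDomainAlgHom R R (laurentExponent n)

theorem toLaurent_injective : Function.Injective (toLaurent (R := R) (n := n)) :=
  AddMonoidAlgebra.mapDomain_injective laurentExponent_injective

theorem toLaurent_monomial (k : Fin n →₀ ℕ) (r : R) :
    toLaurent (MvPolynomial.monomial k r) = AddMonoidAlgebra.single (laurentExponent n k) r :=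
  AddMonoidAlgebra.mapDomain_single

theorem prod_X_pow (N : ℕ) : (∏ i : Fin n, MvPolynomial.X i : MvPolynomial (Fin n) R) ^ N =
    MvPolynomial.monomial (Finsupp.equivFunOnFinite.symm fun _ => N) 1 := by
  rw [← Finset.prod_pow, MvPolynomial.monomial_eq, map_one, one_mul,
    Finsupp.prod_fintype _ _ fun _ => pow_zero _]
  rfl

theorem exists_mul_toLaurent_prod_X_pow_eq (a : Laurent R n) :
    ∃ (N : ℕ) (p : MvPolynomial (Fin n) R),
      a * toLaurent (∏ i, MvPolynomial.X i) ^ N = toLaurent p := by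
  induction a using AddMonoidAlgebra.induction_linear with
  | zero => exact ⟨0, 0, by simp⟩
  | add a b ha hb =>
    obtain ⟨N, p, hp⟩ := ha
    obtain ⟨M, q, hq⟩ := hb
    refine ⟨N + M, p * (∏ i, MvPolynomial.X i) ^ M + q * (∏ i, MvPolynomial.X i) ^ N, ?_⟩
    rw [map_add, map_mul, map_mul, ← hp, ← hq, map_pow, map_pow]
    ring
  | single m r =>
    let N := ∑ i, (m i).natAbs
    have hN (i : Fin n) : ((m i + N).toNat : ℤ) = m i + N := by
      have : (m i).natAbs ≤ N :=
        Finset.single_le_sum (f := fun i => (m i).natAbs) (fun _ _ => Nat.zero_le _)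
          (Finset.mem_univ i)
      omega
    refine ⟨N, .monomial (Finsupp.equivFunOnFinite.symm fun i => (m i + N).toNat) r, ?_⟩
    rw [← map_pow, prod_X_pow, toLaurent_monomial, toLaurent_monomial,
      AddMonoidAlgebra.single_mul_single, mul_one]
    exact congrArg (AddMonoidAlgebra.single · r) (funext fun i => (hN i).symm)

theorem isUnit_toLaurent_prod_X :
    IsUnit (toLaurent (∏ i : Fin n, MvPolynomial.X i : MvPolynomial (Fin n) R)) := by
  rw [← pow_one (∏ i, _), prod_X_pow, toLaurent_monomial]
  refine .of_mul_eq_one (AddMonoidAlgebra.single (fun _ => -1) 1) ?_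
  rw [AddMonoidAlgebra.single_mul_single, AddMonoidAlgebra.one_def, one_mul]
  rfl

theorem isUnit_toLaurent_X (i : Fin n) :
    IsUnit (toLaurent (MvPolynomial.X i : MvPolynomial (Fin n) R)) :=
  isUnit_of_dvd_unit (map_dvd toLaurent (Finset.dvd_prod_of_mem _ (Finset.mem_univ i)))
    isUnit_toLaurent_prod_X

/-- The Laurent polynomials as an algebra over the polynomials. -/
@[reducible] def laurentAlgebra : Algebra (MvPolynomial (Fin n) R) (Laurent R n) :=
  toLaurent.toAlgebra

attribute [local instance] laurentAlgebra

instance isLocalization_laurent :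
    IsLocalization.Away (∏ i : Fin n, MvPolynomial.X i : MvPolynomial (Fin n) R) (Laurent R n) :=
  .mk _ isUnit_toLaurent_prod_X exists_mul_toLaurent_prod_X_pow_eq
    fun _ _ h => ⟨0, by rw [toLaurent_injective h]⟩

instance smooth_laurent : Algebra.Smooth R (Laurent R n) := by
  have : IsScalarTower R (MvPolynomial (Fin n) R) (Laurent R n) :=
    .of_algebraMap_eq fun z => (toLaurent.commutes z).symm
  have : Algebra.Smooth (MvPolynomial (Fin n) R) (Laurent R n) :=
    .of_isLocalization_Away (∏ i : Fin n, MvPolynomial.X i)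
  have : Algebra.Smooth R (MvPolynomial (Fin n) R) := ⟨inferInstance, inferInstance⟩
  exact .comp R (MvPolynomial (Fin n) R) (Laurent R n)

instance isNoetherianRing_laurent [IsNoetherianRing R] : IsNoetherianRing (Laurent R n) :=
  IsLocalization.isNoetherianRing
    (.powers (∏ i : Fin n, MvPolynomial.X i : MvPolynomial (Fin n) R)) _ inferInstance

end Laurent

section Torus

attribute [local instance] specOver

variable {n : ℕ}

instance smooth_torus (n : ℕ) : Smooth (torus n ↘ SpecC) := by
  change Smooth (Spec.map _)
  rw [HasRingHomProperty.Spec_iff (P := @Smooth)]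
  exact RingHom.smooth_algebraMap.2 smooth_laurent

/-- The point of the torus with the given nonzero coordinates. -/
def laurentPoint (x : Fin n → ℂ) (hx : ∀ i, x i ≠ 0) : AlgPoints (Laurent ℂ n) :=
  AddMonoidAlgebra.lift ℂ ℂ (Fin n → ℤ)
    { toFun := fun m => ∏ i, x i ^ (Multiplicative.toAdd m i)
      map_one' := by simp
      map_mul' := fun a b => by
        rw [← Finset.prod_mul_distrib]
        exact Finset.prod_congr rfl fun i _ => zpow_add₀ (hx i) _ _ }

theorem laurentPoint_single (x : Fin n → ℂ) (hx : ∀ i, x i ≠ 0) (m : Fin n → ℤ) (r : ℂ) :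
    laurentPoint x hx (AddMonoidAlgebra.single m r) = r * ∏ i, x i ^ m i :=
  AddMonoidAlgebra.lift_single _ _ _

theorem laurentPoint_toLaurent (x : Fin n → ℂ) (hx : ∀ i, x i ≠ 0) (p : MvPolynomial (Fin n) ℂ) :
    laurentPoint x hx (toLaurent p) = MvPolynomial.eval x p := by
  induction p using MvPolynomial.induction_on' with
  | monomial k r =>
    rw [toLaurent_monomial, laurentPoint_single, MvPolynomial.eval_monomial,
      Finsupp.prod_fintype _ _ fun _ => pow_zero _]
    exact congrArg (r * ·) (Finset.prod_congr rfl fun i _ => zpow_natCast _ _)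
  | add p q hp hq => rw [map_add, map_add, map_add, hp, hq]

namespace AlgPoints

/-- The coordinates of a point of the torus. -/
def laurentCoords (χ : AlgPoints (Laurent ℂ n)) (i : Fin n) : ℂ :=
  χ (toLaurent (MvPolynomial.X i))

theorem continuous_laurentCoords : Continuous (laurentCoords (n := n)) :=
  continuous_pi fun _ => continuous_apply _

theorem laurentCoords_ne_zero (χ : AlgPoints (Laurent ℂ n)) (i : Fin n) : χ.laurentCoords i ≠ 0 :=
  ((isUnit_toLaurent_X i).map χ).ne_zero

theorem apply_toLaurent (χ : AlgPoints (Laurent ℂ n)) (p : MvPolynomial (Fin n) ℂ) :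
    χ (toLaurent p) = MvPolynomial.eval χ.laurentCoords p := by
  rw [MvPolynomial.aeval_unique toLaurent, apply_aeval]
  rfl

theorem laurent_ext {χ ψ : AlgPoints (Laurent ℂ n)} (h : χ.laurentCoords = ψ.laurentCoords) :
    χ = ψ := by
  have hpoly (p : MvPolynomial (Fin n) ℂ) : χ (toLaurent p) = ψ (toLaurent p) := by
    rw [apply_toLaurent, apply_toLaurent, h]
  refine DFunLike.ext _ _ fun a => ?_
  obtain ⟨N, p, hp⟩ := exists_mul_toLaurent_prod_X_pow_eq a
  have hχ := congrArg χ hp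
  have hψ := congrArg ψ hp
  rw [map_mul, map_pow, hpoly, hpoly, ← hψ, map_mul, map_pow] at hχ
  exact mul_right_cancel₀ (pow_ne_zero N (isUnit_toLaurent_prod_X.map ψ).ne_zero) hχ

theorem laurentCoords_laurentPoint (x : Fin n → ℂ) (hx : ∀ i, x i ≠ 0) :
    (laurentPoint x hx).laurentCoords = x :=
  funext fun i => (laurentPoint_toLaurent x hx _).trans (MvPolynomial.eval_X i)

end AlgPoints

/-- The points of the torus outside the common zeros of two polynomials, as points of the algebra
of Laurent polynomials. -/
def torusComplPoint {f g : MvPolynomial (Fin n) ℂ} (x : torusCompl f g) : AlgPoints (Laurent ℂ n) :=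
  laurentPoint x.1 x.2.1

variable (f g : MvPolynomial (Fin n) ℂ)

theorem range_torusComplPoint : range (torusComplPoint (f := f) (g := g)) =
    {χ | χ (toLaurent f) ≠ 0 ∨ χ (toLaurent g) ≠ 0} := by
  ext χ
  constructor
  · rintro ⟨x, rfl⟩
    simpa only [torusComplPoint, mem_ofPred_eq, laurentPoint_toLaurent] using x.2.2
  · intro hχ
    rw [mem_ofPred_eq, χ.apply_toLaurent f, χ.apply_toLaurent g] at hχ
    exact ⟨⟨_, χ.laurentCoords_ne_zero, hχ⟩,
      AlgPoints.laurent_ext (AlgPoints.laurentCoords_laurentPoint _ _)⟩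

theorem continuous_torusComplPoint : Continuous (torusComplPoint (f := f) (g := g)) := by
  refine continuous_induced_rng.2 (continuous_pi fun a => ?_)
  change Continuous fun x : torusCompl f g => laurentPoint x.1 x.2.1 a
  induction a using AddMonoidAlgebra.induction_linear with
  | zero => simpa only [map_zero] using continuous_const
  | add a b ha hb => simpa only [map_add] using ha.fun_add hb
  | single m r =>
    simp only [laurentPoint_single]
    refine continuous_const.mul (continuous_finsetProd _ fun i _ => ?_)
    exact ((continuous_apply i).comp continuous_subtype_val).zpow₀ _ fun x => .inl (x.2.1 i)

theorem isOpenEmbedding_torusComplPoint : IsOpenEmbedding (torusComplPoint (f := f) (g := g)) := by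
  have hcoords : AlgPoints.laurentCoords ∘ torusComplPoint (f := f) (g := g) = Subtype.val :=
    funext fun x => AlgPoints.laurentCoords_laurentPoint x.1 x.2.1
  have hemb : IsEmbedding (torusComplPoint (f := f) (g := g)) :=
    .of_comp (continuous_torusComplPoint f g) AlgPoints.continuous_laurentCoords
      (hcoords ▸ .subtypeVal)
  refine ⟨hemb, ?_⟩
  rw [range_torusComplPoint]
  exact (isOpen_ne_fun (AlgPoints.continuous_apply _) continuous_const).union
    (isOpen_ne_fun (AlgPoints.continuous_apply _) continuous_const)

end Torus

/-! ### Cluster type pairs -/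

section Pair

attribute [local instance] specOver

variable {X : Scheme.{0}} {B : AlgebraicCycle X ℤ}

theorem isClosed_divisorSupport (B : AlgebraicCycle X ℤ) : IsClosed (divisorSupport B) := by
  rw [← isOpen_compl_iff, isOpen_iff_mem_nhds]
  intro y hy
  obtain ⟨t, ht, hfin⟩ := B.supportLocallyFiniteWithinDomain' y trivial
  obtain ⟨V, hVt, hV, hyV⟩ := mem_nhds_iff.1 ht
  have hcl : IsClosed (⋃ z ∈ t ∩ Function.support B.toFun, closure {z}) :=
    hfin.isClosed_biUnion fun _ _ => isClosed_closure
  refine Filter.mem_of_superset ((hV.inter hcl.isOpen_compl).mem_nhds ⟨hyV, fun h => hy ?_⟩) ?_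
  · simp only [mem_iUnion] at h
    obtain ⟨z, hz, hyz⟩ := h
    exact mem_biUnion (show z ∈ {z : X | B z ≠ 0} from hz.2) hyz
  · rintro w ⟨hwV, hw⟩ hwB
    simp only [divisorSupport, mem_iUnion] at hwB
    obtain ⟨z, hz, hwz⟩ := hwB
    obtain ⟨z', hzV, rfl⟩ := mem_closure_iff.1 hwz V hV hwV
    exact hw (mem_biUnion (show z' ∈ t ∩ Function.support B.toFun from ⟨hVt hzV, hz⟩) hwz)

theorem notMem_divisorSupport {U : X.Opens} (h : ∀ z ∈ U, B z = 0) {y : X} (hy : y ∈ U) :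
    y ∉ divisorSupport B := by
  intro hyB
  simp only [divisorSupport, mem_iUnion] at hyB
  obtain ⟨z, hz, hyz⟩ := hyB
  obtain ⟨z', hzU, rfl⟩ := mem_closure_iff.1 hyz U U.2 hy
  exact hz (h _ hzU)

theorem isOpen_smoothComplement [X.Over SpecC] [LocallyOfFiniteType (X ↘ SpecC)]
    (B : AlgebraicCycle X ℤ) :
    IsOpen {p : ComplexPoints X | p.pt ∈ (X ↘ SpecC).smoothLocus ∧ p.pt ∉ divisorSupport B} :=
  ComplexPoints.isOpen_setOf_pt_mem
    ((X ↘ SpecC).smoothLocus ⊓ ⟨(divisorSupport B)ᶜ, (isClosed_divisorSupport B).isOpen_compl⟩)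

theorem isUnit_torusCoord (n : ℕ) (i : Fin n) : IsUnit (torusCoord n i) := by
  refine IsUnit.map (Scheme.ΓSpecIso (.of (Laurent ℂ n))).inv.hom ?_
  refine .of_mul_eq_one (AddMonoidAlgebra.single (-Pi.single i 1) 1) ?_
  rw [AddMonoidAlgebra.single_mul_single, AddMonoidAlgebra.one_def, one_mul, add_neg_cancel]

/-- The open subset of the torus on which one of two polynomials does not vanish. -/
def torusOpen {n : ℕ} (f g : MvPolynomial (Fin n) ℂ) : (torus n).Opens :=
  PrimeSpectrum.basicOpen (toLaurent f) ⊔ PrimeSpectrum.basicOpen (toLaurent g)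

theorem nonempty_torusOpen {n : ℕ} {f : MvPolynomial (Fin n) ℂ} (hf : f ≠ 0)
    (g : MvPolynomial (Fin n) ℂ) : (torusOpen f g : Set (torus n)).Nonempty := by
  refine ⟨(⟨⊥, Ideal.isPrime_bot⟩ : PrimeSpectrum (Laurent ℂ n)), .inl fun h => hf ?_⟩
  exact toLaurent_injective (by rw [map_zero]; exact h)

/-- The complex point of the torus with coordinates in the complement of the common zeros of two
polynomials. -/
def torusPoint {n : ℕ} {f g : MvPolynomial (Fin n) ℂ} (x : torusCompl f g) :
    ComplexPoints (torus n) :=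
  (torusComplPoint x).toComplexPoint

theorem isOpenEmbedding_torusPoint {n : ℕ} (f g : MvPolynomial (Fin n) ℂ) :
    IsOpenEmbedding (torusPoint (f := f) (g := g)) :=
  AlgPoints.isHomeomorph_toComplexPoint.isOpenEmbedding.comp (isOpenEmbedding_torusComplPoint f g)

theorem range_torusPoint {n : ℕ} (f g : MvPolynomial (Fin n) ℂ) :
    range (torusPoint (f := f) (g := g)) = {p | p.pt ∈ torusOpen f g} := by
  refine (range_comp AlgPoints.toComplexPoint torusComplPoint).trans ?_
  rw [range_torusComplPoint]
  ext p
  obtain ⟨χ, rfl⟩ := AlgPoints.toComplexPoint_bijective.2 p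
  refine (AlgPoints.toComplexPoint_bijective.1.mem_set_image).trans ?_
  exact or_congr (χ.pt_toComplexPoint_mem_basicOpen _).symm
    (χ.pt_toComplexPoint_mem_basicOpen _).symm

namespace CodimOneEmbedding

variable {n : ℕ} [X.Over SpecC] (j : CodimOneEmbedding n X)

theorem exists_coord_eq [IsIntegral X] (i : Fin n) {z : X} (hz : z ∈ j.hom.opensRange) :
    ∃ u : (X.presheaf.stalk z)ˣ, j.coord i = algebraMap _ X.functionField u.1 := by
  have hz' : z ∈ j.hom ''ᵁ ⊤ := by rwa [Scheme.Hom.image_top_eq_opensRange]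
  have hunit : IsUnit (X.presheaf.germ (j.hom ''ᵁ ⊤) z hz'
      ((j.hom.appIso ⊤).inv (j.dom.ι.appTop (torusCoord n i)))) :=
    (((isUnit_torusCoord n i).map j.dom.ι.appTop.hom).map (j.hom.appIso ⊤).inv.hom).map
      (X.presheaf.germ (j.hom ''ᵁ ⊤) z hz').hom
  obtain ⟨u, hu⟩ := hunit
  refine ⟨u, ?_⟩
  rw [hu]
  exact (Scheme.algebraMap_germ_eq_germToFunctionField X hz' _).symm

theorem volumeForm_mem_regularFormsAt [IsIntegral X] {z : X} (hz : z ∈ j.hom.opensRange) :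
    j.volumeForm ∈ regularFormsAt n z := by
  choose u hu using fun i => j.exists_coord_eq i hz
  have hform : j.volumeForm = (∏ i, (j.coord i)⁻¹) • exteriorPower.ιMulti X.functionField n
      fun i => KaehlerDifferential.D ℂ X.functionField (j.coord i) :=
    (exteriorPower.ιMulti X.functionField n).toMultilinearMap.map_smul_univ _ _
  have hcoeff : ∏ i, (j.coord i)⁻¹ = algebraMap (X.presheaf.stalk z) X.functionField
      (∏ i, ((u i)⁻¹ : (X.presheaf.stalk z)ˣ).1) := by
    rw [map_prod]
    refine Finset.prod_congr rfl fun i _ => ?_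
    rw [hu, inv_eq_of_mul_eq_one_right]
    rw [← map_mul, Units.mul_inv, map_one]
  rw [hform, hcoeff]
  refine Submodule.smul_mem (regularFormsAt n z) ⟨_, ⟨_, rfl⟩⟩
    (Submodule.subset_span ⟨fun i => (u i).1, ?_⟩)
  simp only [← hu]

theorem poleOrder_volumeForm [IsIntegral X] {z : X} (hz : z ∈ j.hom.opensRange) :
    poleOrder j.volumeForm z = 0 :=
  Nat.sInf_eq_zero.2 (.inl fun a _ =>
    Submodule.smul_mem (regularFormsAt n z) ⟨_, ⟨a, rfl⟩⟩ (j.volumeForm_mem_regularFormsAt hz))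

theorem exists_isOpenEmbedding_dom {f g : MvPolynomial (Fin n) ℂ} (h : torusOpen f g ≤ j.dom) :
    ∃ d : torusCompl f g → ComplexPoints j.dom,
      IsOpenEmbedding d ∧ range d = {q | j.dom.ι q.pt ∈ torusOpen f g} := by
  have hι := ComplexPoints.isOpenEmbedding_map j.dom.ι
  obtain ⟨d, hd⟩ : ∃ d : torusCompl f g → ComplexPoints j.dom,
      torusPoint = ComplexPoints.map j.dom.ι ∘ d := by
    rw [← range_subset_range_iff_exists_comp, range_torusPoint, ComplexPoints.range_map,
      Scheme.Opens.opensRange_ι]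
    exact fun p hp => h hp
  refine ⟨d, .of_comp _ hι (hd ▸ isOpenEmbedding_torusPoint f g), ?_⟩
  rw [← hι.injective.preimage_image (range d), ← range_comp, ← hd, range_torusPoint]
  rfl

variable [LocallyOfFiniteType (X ↘ SpecC)]

theorem opensRange_le_smoothLocus : j.hom.opensRange ≤ (X ↘ SpecC).smoothLocus := by
  rintro _ ⟨y, rfl⟩
  have h : j.hom ⁻¹ᵁ (X ↘ SpecC).smoothLocus = ⊤ := by
    rw [Scheme.Hom.preimage_smoothLocus_eq, Scheme.Hom.smoothLocus_eq_top_iff, comp_over]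
    exact inferInstanceAs (Smooth (j.dom.ι ≫ torus n ↘ SpecC))
  exact h.ge trivial

/-- The map induced by `j` from the complex points of its domain to those of the complement of a
divisor which does not meet its image. -/
def toSmoothComplement (hB : ∀ z ∈ j.hom.opensRange, B z = 0) (q : ComplexPoints j.dom) :
    SmoothComplement X B :=
  ⟨.map j.hom q, j.opensRange_le_smoothLocus ⟨q.pt, rfl⟩, notMem_divisorSupport hB ⟨q.pt, rfl⟩⟩

theorem isOpenEmbedding_toSmoothComplement (hB : ∀ z ∈ j.hom.opensRange, B z = 0) :
    IsOpenEmbedding (j.toSmoothComplement hB) :=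
  .of_comp _ (isOpen_smoothComplement B).isOpenEmbedding_subtypeVal
    (ComplexPoints.isOpenEmbedding_map j.hom)

theorem isTame_toSmoothComplement [IsIntegral X] (hB : ∀ z ∈ j.hom.opensRange, B z = 0)
    {U : (torus n).Opens} (hU : (U : Set (torus n)).Nonempty) (hUdom : U ≤ j.dom) :
    IsTame (j.toSmoothComplement hB '' {q | j.dom.ι q.pt ∈ U}) := by
  obtain ⟨z, hz⟩ := hU
  have : Nonempty (j.hom ''ᵁ (j.dom.ι ⁻¹ᵁ U)) := ⟨⟨j.hom ⟨z, hUdom hz⟩, ⟨_, hz, rfl⟩⟩⟩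
  refine (isTame_setOf_pt_mem X (isOpen_smoothComplement B) (fun p hp => hp.1)
    (j.hom ''ᵁ (j.dom.ι ⁻¹ᵁ U))).mono ?_
  rintro ⟨y, hy⟩ ⟨v, hvU, hv⟩
  obtain ⟨q, rfl⟩ : y ∈ range (ComplexPoints.map j.hom) := by
    rw [ComplexPoints.range_map]
    exact ⟨v, hv⟩
  obtain rfl : v = q.pt := j.hom.injective hv
  exact ⟨q, hvU, rfl⟩

theorem hasLatticeFundamentalGroup_smoothComplement [IsIntegral X]
    (hB : ∀ z ∈ j.hom.opensRange, B z = 0) {f g : MvPolynomial (Fin n) ℂ} (hf : f ≠ 0)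
    (hfg : IsRelPrime f g) (h : torusOpen f g ≤ j.dom) :
    HasLatticeFundamentalGroup n (SmoothComplement X B) := by
  obtain ⟨d, hd, hrange⟩ := j.exists_isOpenEmbedding_dom h
  have hemb := (j.isOpenEmbedding_toSmoothComplement hB).comp hd
  have htame := j.isTame_toSmoothComplement hB (nonempty_torusOpen hf g) h
  rw [← hrange, ← range_comp] at htame
  exact (hasLatticeFundamentalGroup_torusCompl hfg).of_isTame ⟨_, hemb.continuous⟩ hemb htame

end CodimOneEmbedding

end Pair

/-! ### Closed subsets of codimension two -/

section Codimension

theorem exists_mem_isRelPrime {R : Type*} [CommRing R] [UniqueFactorizationMonoid R]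
    {J : Ideal R} {f : R} (hf : f ≠ 0) (hJ : ∀ q, Prime q → q ∣ f → ¬ J ≤ Ideal.span {q}) :
    ∃ g ∈ J, IsRelPrime f g := by
  classical
  let factors := (UniqueFactorizationMonoid.factors f).toFinset
  have hprime {q : R} (hq : q ∈ factors) : Prime q :=
    UniqueFactorizationMonoid.prime_of_factor q (Multiset.mem_toFinset.1 hq)
  obtain ⟨g, hgJ, hg⟩ : ∃ g ∈ J, ∀ q ∈ factors, ¬ q ∣ g := by
    by_contra! h
    have hsub : (J : Set R) ⊆ ⋃ q ∈ (factors : Set R), (Ideal.span {q} : Ideal R) := by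
      intro g hg
      obtain ⟨q, hq, hqg⟩ := h g hg
      exact mem_biUnion hq (Ideal.mem_span_singleton.2 hqg)
    rw [Ideal.subset_union_prime 0 0 fun q hq _ _ =>
      (Ideal.span_singleton_prime (hprime hq).ne_zero).2 (hprime hq)] at hsub
    obtain ⟨q, hq, hle⟩ := hsub
    exact hJ q (hprime hq)
      (UniqueFactorizationMonoid.dvd_of_mem_factors (Multiset.mem_toFinset.1 hq)) hle
  refine ⟨g, hgJ, fun d hdf hdg => ?_⟩
  by_contra hd
  obtain ⟨p, hp, hpd⟩ := WfDvdMonoid.exists_irreducible_factor hd (ne_zero_of_dvd_ne_zero hf hdf)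
  obtain ⟨q, hq, hpq⟩ :=
    UniqueFactorizationMonoid.exists_mem_factors_of_dvd hf hp (hpd.trans hdf)
  exact hg q (Multiset.mem_toFinset.2 hq) (hpq.symm.dvd.trans (hpd.trans hdg))

section Localization

variable {R S : Type*} [CommRing R] [CommRing S] [Algebra R S] {I : Ideal S}

theorem exists_ne_zero_algebraMap_mem_forall_prime_not_isUnit [WfDvdMonoid R]
    (hI : I.comap (algebraMap R S) ≠ ⊥) :
    ∃ f : R, f ≠ 0 ∧ algebraMap R S f ∈ I ∧ ∀ q, Prime q → q ∣ f → ¬ IsUnit (algebraMap R S q) := by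
  obtain ⟨f₀, hf₀⟩ := Submodule.exists_mem_ne_zero_of_ne_bot hI
  obtain ⟨f, ⟨hfI, hf⟩, hmin⟩ := (wellFounded_dvdNotUnit (α := R)).has_min
    {f : R | algebraMap R S f ∈ I ∧ f ≠ 0} ⟨f₀, hf₀⟩
  refine ⟨f, hf, hfI, ?_⟩
  rintro q hq ⟨h, rfl⟩ hunit
  rw [map_mul, Ideal.unit_mul_mem_iff_mem I hunit] at hfI
  have hh : h ≠ 0 := right_ne_zero_of_mul hf
  exact hmin h ⟨hfI, hh⟩ ⟨hh, q, hq.not_isUnit, mul_comm q h⟩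

theorem exists_isRelPrime_algebraMap_mem [IsDomain R] [UniqueFactorizationMonoid R] [IsDomain S]
    (M : Submonoid R) [IsLocalization M S]
    (hI : ∀ P : Ideal S, P.IsPrime → P.IsPrincipal → ¬ I ≤ P) :
    ∃ f g : R, f ≠ 0 ∧ IsRelPrime f g ∧ algebraMap R S f ∈ I ∧ algebraMap R S g ∈ I := by
  have hmap : (I.comap (algebraMap R S)).map (algebraMap R S) = I :=
    IsLocalization.map_under M S I
  obtain ⟨f, hf, hfI, hfq⟩ : ∃ f : R, f ≠ 0 ∧ algebraMap R S f ∈ I ∧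
      ∀ q, Prime q → q ∣ f → ¬ IsUnit (algebraMap R S q) := by
    refine exists_ne_zero_algebraMap_mem_forall_prime_not_isUnit fun h => ?_
    refine hI ⊥ Ideal.isPrime_bot inferInstance ?_
    rw [← hmap, h, Ideal.map_bot]
  obtain ⟨g, hgI, hfg⟩ : ∃ g ∈ I.comap (algebraMap R S), IsRelPrime f g := by
    refine exists_mem_isRelPrime hf fun q hq hqf hle => ?_
    have hdisj : Disjoint (M : Set R) (Ideal.span {q} : Ideal R) := by
      refine Set.disjoint_left.2 fun m hm hqm => hfq q hq hqf ?_
      exact isUnit_of_dvd_unit (map_dvd _ (Ideal.mem_span_singleton.1 hqm))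
        (IsLocalization.map_units S ⟨m, hm⟩)
    have hprime := IsLocalization.isPrime_of_isPrime_disjoint M S _
      ((Ideal.span_singleton_prime hq.ne_zero).2 hq) hdisj
    refine hI _ hprime ?_ (hmap ▸ Ideal.map_mono hle)
    rw [Ideal.map_span, Set.image_singleton]
    exact ⟨_, rfl⟩
  exact ⟨f, g, hf, hfg, hfI, hgI⟩

end Localization

theorem not_vanishingIdeal_le_of_isPrincipal {R : Type*} [CommRing R] [IsNoetherianRing R]
    {Z : Set (PrimeSpectrum R)} (hZ : IsClosed Z) (hheight : ∀ z ∈ Z, 2 ≤ z.asIdeal.height)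
    (P : Ideal R) (hP : P.IsPrime) (hP' : P.IsPrincipal) :
    ¬ PrimeSpectrum.vanishingIdeal Z ≤ P := by
  intro hle
  have hmem : (⟨P, hP⟩ : PrimeSpectrum R) ∈ Z := by
    rw [← hZ.closure_eq, ← PrimeSpectrum.zeroLocus_vanishingIdeal_eq_closure,
      PrimeSpectrum.mem_zeroLocus]
    exact hle
  have hheight' : P.height ≤ 1 :=
    Ideal.height_le_one_of_isPrincipal_of_mem_minimalPrimes P P
      (by rw [Ideal.minimalPrimes_eq_subsingleton_self]; rfl)
  exact absurd ((hheight _ hmem).trans hheight') (by decide)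

attribute [local instance] laurentAlgebra

theorem exists_isRelPrime_torusOpen_le {n : ℕ} (U : (torus n).Opens)
    (hU : ∀ z : torus n, z ∉ U → 2 ≤ Order.coheight z) :
    ∃ f g : MvPolynomial (Fin n) ℂ, f ≠ 0 ∧ IsRelPrime f g ∧ torusOpen f g ≤ U := by
  let Z : Set (PrimeSpectrum (Laurent ℂ n)) := {z : torus n | z ∉ U}
  have hZ : IsClosed Z := U.2.isClosed_compl
  have hheight (z : PrimeSpectrum (Laurent ℂ n)) (hz : z ∈ Z) : 2 ≤ z.asIdeal.height :=
    (hU z hz).trans (idealHeight_eq_coheight (.of (Laurent ℂ n)) z).ge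
  obtain ⟨f, g, hf, hfg, hfZ, hgZ⟩ := exists_isRelPrime_algebraMap_mem
    (.powers (∏ i : Fin n, MvPolynomial.X i : MvPolynomial (Fin n) ℂ))
    (not_vanishingIdeal_le_of_isPrincipal hZ hheight)
  rw [PrimeSpectrum.mem_vanishingIdeal] at hfZ hgZ
  refine ⟨f, g, hf, hfg, ?_⟩
  rintro z (hz | hz) <;> by_contra hzU
  · exact hz (hfZ z hzU)
  · exact hz (hgZ z hzU)

end Codimension

end ClusterType

end

theorem mainTheorem5_general (n : ℕ) (X : Scheme.{0}) [X.Over ClusterType.SpecC] [IsIntegral X]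
    [LocallyOfFiniteType (X ↘ ClusterType.SpecC)] (j : ClusterType.CodimOneEmbedding n X)
    (B : AlgebraicCycle X ℤ) (hB : ∀ z ∈ j.hom.opensRange, B z = 0) :
    PathConnectedSpace (ClusterType.SmoothComplement X B) ∧
    ∀ x : ClusterType.SmoothComplement X B,
      (∀ a b : FundamentalGroup (ClusterType.SmoothComplement X B) x, a * b = b * a) ∧
      (∃ _ : Group.FG (FundamentalGroup (ClusterType.SmoothComplement X B) x),
        Group.rank (FundamentalGroup (ClusterType.SmoothComplement X B) x) ≤ n) ∧
      ∃ φ : Multiplicative (Fin n → ℤ) →* FundamentalGroup (ClusterType.SmoothComplement X B) x,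
        Function.Surjective φ := by
  obtain ⟨f, g, hf, hfg, hdom⟩ :=
    ClusterType.exists_isRelPrime_torusOpen_le j.dom j.two_le_codim
  have h := j.hasLatticeFundamentalGroup_smoothComplement hB hf hfg hdom
  exact ⟨h.pathConnectedSpace, fun x => ⟨(h.isLatticeQuotient x).mul_comm,
    (h.isLatticeQuotient x).fg_and_rank_le, h.isLatticeQuotient x⟩⟩

theorem mainTheorem5 (n : ℕ) (X : Scheme.{0}) [X.Over ClusterType.SpecC] [IsIntegral X]
    [IsSeparated (X ↘ ClusterType.SpecC)] [LocallyOfFiniteType (X ↘ ClusterType.SpecC)]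
    [QuasiCompact (X ↘ ClusterType.SpecC)]
    (hnormal : ∀ x : X, IsIntegrallyClosed (X.presheaf.stalk x))
    (hdim : topologicalKrullDim X = n)
    (B : AlgebraicCycle X ℤ) (hB : ClusterType.IsClusterTypePair n X B) :
    PathConnectedSpace (ClusterType.SmoothComplement X B) ∧
    ∀ x : ClusterType.SmoothComplement X B,
      (∀ a b : FundamentalGroup (ClusterType.SmoothComplement X B) x, a * b = b * a) ∧
      (∃ _ : Group.FG (FundamentalGroup (ClusterType.SmoothComplement X B) x),
        Group.rank (FundamentalGroup (ClusterType.SmoothComplement X B) x) ≤ n) ∧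
      ∃ φ : Multiplicative (Fin n → ℤ) →* FundamentalGroup (ClusterType.SmoothComplement X B) x,
        Function.Surjective φ := by
  obtain ⟨j, -, hBj⟩ := hB
  exact mainTheorem5_general n X j B fun z hz => by
    rw [hBj, j.poleOrder_volumeForm hz, Nat.cast_zero, ite_self]
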